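/- Let $\mathfrak T=\langle\mathcal T,\mathit{Sat},\overline{\,\cdot\,}\rangle$ be an abstract theory: a set $\mathcal T$ of theory atoms, a family $\mathit{Sat}\subseteq 2^{\mathcal T}$ of $\mathfrak T$-satisfiable sets, and a complement $\overline{\,\cdot\,}:\mathcal T\to\mathcal T$ with $\overline{\overline{s}}=s$. Assume that $\mathfrak T$ is consistent (no set in $\mathit{Sat}$ contains both $s$ and $\overline s$), and that it has a structure, that is, a set $\mathcal X$ of variables, a domain $\mathcal D$, sets $\mathit{vars}(s)\subseteq\mathcal X$ with $\mathit{vars}(\overline s)=\mathit{vars}(s)$, and denotations $[\![s]\!]\subseteq\mathcal D^{\mathcal X}$ that depend only on the values of the variables in $\mathit{vars}(s)$, which is compositional ($S\in\mathit{Sat}$ iff $\bigcap_{s\in S}[\![s]\!]\neq\emptyset$) and has an absolute complement ($[\![\overline s]\!]=\mathcal D^{\mathcal X}\setminus[\![s]\!]$). Let $\mathcal A$ be a set of regular atoms, disjoint from $\mathcal T$. Regular and theory atoms are named by strings over finite alphabets, and the complement is computable in polynomial time on the names of theory atoms. A $\mathcal T$-program is a set of rules $b_0\leftarrow b_1,\dots,b_n,\neg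 b_{n+1},\dots,\neg b_m$ with $b_i\in\mathcal A\cup\mathcal T$ for $i\ge 1$ and $b_0\in\mathcal A\cup\mathcal T\cup\{\bot\}$. A set $\mathcal E\subseteq\mathcal T$ is closed if $s\in\mathcal E$ implies $\overline s\in\mathcal E$. A set $X\subseteq\mathcal A\cup\mathcal T$ is a $\langle\mathfrak T,\mathcal E\rangle$-stable model of $P$ if $X\cap\mathcal T\in\mathit{Sat}$ and $X$ is a stable model (in the sense of propositional equilibrium logic over the atoms $\mathcal A\cup\mathcal T$) of $P\cup\{s\vee\overline s\mid s\in\mathcal E\}$. Consider the satisfiability problem for $\mathcal T$-programs with theory $\mathfrak T$. An instance consists of a closed set $\mathcal E\subseteq\mathcal T$ of external theory atoms and a finite $\mathcal T$-program $P$ such that every theory atom occurring in a rule body of $P$ belongs to $\mathcal E$; the question is whether $P$ has a $\langle\mathfrak T,\mathcal E\rangle$-stable model. This problem is in $\mathsf{NP}^{\mathsf O}$, where $\mathsf O$ is an oracle that decides in a single step whether a given finite set of theory atoms is $\mathfrak T$-satisfiable. More precisely, there are a nondeterministic Turing machine with oracle $\mathsf O$ and a polynomial $p$ (depending only on $\mathfrak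 T$ and the naming of atoms, not on $\mathcal E$) such that, for every instance, given only $P$ written as a string of length $\ell$, every computation path halts within $p(\ell)$ steps, and some path accepts iff $P$ has a $\langle\mathfrak T,\mathcal E\rangle$-stable model. -/

import Mathlib

/-! ## The logic of here-and-there with constraints -/

/-- Formulas built from constraint atoms in `C`. -/
inductive HTFormula (C : Type*) where
  | bot : HTFormula C
  | atom : C → HTFormula C
  | and : HTFormula C → HTFormula C → HTFormula C
  | or : HTFormula C → HTFormula C → HTFormula C
  | imp : HTFormula C → HTFormula C → HTFormula C

namespace HTFormula

/-- `⊤` is `⊥ → ⊥`. -/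
def top {C : Type*} : HTFormula C := imp bot bot

/-- `¬ φ` is `φ → ⊥`. -/
def not {C : Type*} (φ : HTFormula C) : HTFormula C := imp φ bot

/-- The conjunction of a finite list of formulas (`⊤` for the empty list). -/
def conj {C : Type*} : List (HTFormula C) → HTFormula C
  | [] => top
  | φ :: l => and φ (conj l)

end HTFormula

/-- A valuation assigns to each variable a value of the domain, or leaves it undefined (`none`). -/
abbrev HTValuation (X D : Type*) := X → Option D

/-- Inclusion of valuations, seen as sets of pairs `x ↦ v(x)` with `v(x)` defined. -/
def HTValuation.Sub {X D : Type*} (v w : HTValuation X D) : Prop :=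
  ∀ x d, v x = some d → w x = some d

/-- Satisfaction of a formula in an interpretation `⟨h, t⟩`, for a given denotation. -/
def HTSat {C X D : Type*} (den : C → Set (HTValuation X D)) :
    HTValuation X D → HTValuation X D → HTFormula C → Prop
  | _, _, .bot => False
  | h, _, .atom c => h ∈ den c
  | h, t, .and φ ψ => HTSat den h t φ ∧ HTSat den h t ψ
  | h, t, .or φ ψ => HTSat den h t φ ∨ HTSat den h t ψ
  | h, t, .imp φ ψ =>
      (¬ HTSat den h t φ ∨ HTSat den h t ψ) ∧ (¬ HTSat den t t φ ∨ HTSat den t t ψ)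

/-- `t` is a stable model of `Φ`: `⟨t, t⟩` is an equilibrium model of `Φ`. -/
def IsStableModel {C X D : Type*} (den : C → Set (HTValuation X D)) (Φ : Set (HTFormula C))
    (t : HTValuation X D) : Prop :=
  (∀ φ ∈ Φ, HTSat den t t φ) ∧
    ¬ ∃ h : HTValuation X D, h.Sub t ∧ h ≠ t ∧ ∀ φ ∈ Φ, HTSat den h t φ

/-- The denotation of regular atoms: each atom is also a variable, over the domain with the single
value "true", and the denotation of `a` collects the valuations that make `a` true. -/
def regularDen {C : Type*} (a : C) : Set (HTValuation C Unit) := {v | v a = some ()}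

open Classical in
/-- The valuation that makes exactly the members of `X` true and leaves all others undefined. -/
noncomputable def regularValuation {C : Type*} (X : Set C) : HTValuation C Unit :=
  fun a => if a ∈ X then some () else none

/-- `X` is a regular stable model of `Φ`. -/
def IsRegularStableModel {C : Type*} (Φ : Set (HTFormula C)) (X : Set C) : Prop :=
  IsStableModel regularDen Φ (regularValuation X)

/-! ## Theories -/

/-- An abstract theory whose theory atoms are the elements of `T`: the satisfiable sets of theory
atoms, and an involutive complement. -/
structure AbstractTheory (T : Type*) where
  Sat : Set (Set T)
  comp : T → T
  comp_comp : ∀ s, comp (comp s) = s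

/-- No satisfiable set contains complementary atoms. -/
def AbstractTheory.Consistent {T : Type*} (𝔗 : AbstractTheory T) : Prop :=
  ∀ S ∈ 𝔗.Sat, ∀ s, ¬ (s ∈ S ∧ 𝔗.comp s ∈ S)

/-- A structure for an abstract theory, with variables `X` and domain `D`; here assignments
are total. -/
structure TheoryStructure {T : Type*} (𝔗 : AbstractTheory T) (X D : Type*) where
  vars : T → Set X
  vars_comp : ∀ s, vars (𝔗.comp s) = vars s
  den : T → Set (X → D)
  den_congr : ∀ s (v w : X → D), (∀ x ∈ vars s, v x = w x) → (v ∈ den s ↔ w ∈ den s)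

/-- The denotation of a set of theory atoms. -/
def TheoryStructure.denSet {T X D : Type*} {𝔗 : AbstractTheory T} (𝔖 : TheoryStructure 𝔗 X D)
    (S : Set T) : Set (X → D) := ⋂ s ∈ S, 𝔖.den s

/-- A set of theory atoms is satisfiable iff its denotation is not empty. -/
def TheoryStructure.Compositional {T X D : Type*} {𝔗 : AbstractTheory T}
    (𝔖 : TheoryStructure 𝔗 X D) : Prop :=
  𝔗.Sat = {S | (𝔖.denSet S).Nonempty}

/-- The denotation of the complement of an atom is the set complement of its denotation. -/
def TheoryStructure.AbsoluteComplement {T X D : Type*} {𝔗 : AbstractTheory T}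
    (𝔖 : TheoryStructure 𝔗 X D) : Prop :=
  ∀ s, 𝔖.den (𝔗.comp s) = (𝔖.den s)ᶜ

/-- A set of theory atoms is closed if it contains the complements of its members. -/
def AbstractTheory.Closed {T : Type*} (𝔗 : AbstractTheory T) (E : Set T) : Prop :=
  ∀ s ∈ E, 𝔗.comp s ∈ E

/-! ## T-programs -/

/-- The rule `b₀ ← b₁, …, bₙ, ¬ bₙ₊₁, …, ¬ bₘ` over regular atoms `A` and theory atoms `T`;
the head `none` stands for `⊥`. -/
structure TRule (A T : Type*) where
  head : Option (A ⊕ T)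
  pos : List (A ⊕ T)
  neg : List (A ⊕ T)

/-- The formula `b₁ ∧ … ∧ bₙ ∧ ¬ bₙ₊₁ ∧ … ∧ ¬ bₘ → b₀`. -/
def TRule.toFormula {A T : Type*} (r : TRule A T) : HTFormula (A ⊕ T) :=
  .imp (.conj (r.pos.map .atom ++ r.neg.map fun b => .not (.atom b)))
    (match r.head with
      | none => .bot
      | some b => .atom b)

/-- `X` is a `⟨𝔗, E⟩`-stable model of the T-program `P`. -/
def IsTheoryStableModel {A T : Type*} (𝔗 : AbstractTheory T) (E : Set T)
    (P : Set (TRule A T)) (X : Set (A ⊕ T)) : Prop :=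
  {s : T | Sum.inr s ∈ X} ∈ 𝔗.Sat ∧
    IsRegularStableModel
      (TRule.toFormula '' P ∪
        (fun s => .or (.atom (Sum.inr s)) (.atom (Sum.inr (𝔗.comp s)))) '' E) X

/-- An instance of the satisfiability problem for T-programs with theory `𝔗`: a finite T-program,
given by a list of its rules, and a closed set `E` of external theory atoms such that founded
theory atoms (those outside `E`) do not occur in rule bodies. -/
structure TProgramInstance (A : Type*) {T : Type*} (𝔗 : AbstractTheory T) where
  E : Set T
  closed : 𝔗.Closed E
  rules : List (TRule A T)
  body_external : ∀ r ∈ rules, ∀ s : T, Sum.inr s ∈ r.pos ∨ Sum.inr s ∈ r.neg → s ∈ E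

/-- The question of the satisfiability problem: is there a `⟨𝔗, E⟩`-stable model? -/
def TProgramInstance.Satisfiable {A T : Type*} {𝔗 : AbstractTheory T}
    (i : TProgramInstance A 𝔗) : Prop :=
  ∃ X : Set (A ⊕ T), IsTheoryStableModel 𝔗 i.E {r | r ∈ i.rules} X

/-! ## Strings for programs and for finite sets of theory atoms -/

/-- The alphabet for programs: the symbols used in the names of regular and of theory atoms, and
six punctuation marks. -/
inductive ProgSym (ΓA ΓT : Type) where
  | regSym (a : ΓA)
  | thySym (b : ΓT)
  | regMark
  | thyMark
  | ruleMark
  | botMark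
  | posMark
  | negMark
  deriving DecidableEq, Fintype

instance {ΓA ΓT : Type} [Finite ΓA] [Finite ΓT] : Finite (ProgSym ΓA ΓT) := by
  classical
  have := Fintype.ofFinite ΓA
  have := Fintype.ofFinite ΓT
  infer_instance

section Codes

variable {A T ΓA ΓT : Type} (encA : Computability.Encoding A ΓA)
  (encT : Computability.Encoding T ΓT)

/-- The string of an atom: a mark for its kind, followed by its name. -/
def atomCode : A ⊕ T → List (ProgSym ΓA ΓT)
  | .inl a => .regMark :: (encA.encode a).map .regSym
  | .inr s => .thyMark :: (encT.encode s).map .thySym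

/-- The string of a rule: its head, then its positive and its negative body literals. -/
def ruleCode (r : TRule A T) : List (ProgSym ΓA ΓT) :=
  .ruleMark ::
    ((match r.head with
      | none => [.botMark]
      | some b => atomCode encA encT b) ++
    r.pos.flatMap (fun b => .posMark :: atomCode encA encT b) ++
    r.neg.flatMap (fun b => .negMark :: atomCode encA encT b))

/-- The string of a finite program. -/
def programCode (P : List (TRule A T)) : List (ProgSym ΓA ΓT) :=
  P.flatMap (ruleCode encA encT)

/-- The string of a finite list of theory atoms: each name is preceded by the separator `none`. -/
def atomListCode (l : List T) : List (Option ΓT) :=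
  l.flatMap fun s => none :: (encT.encode s).map some

/-- The satisfiability problem of the theory, as a set of strings: the finite sets of theory atoms
(listed in any order) that are `𝔗`-satisfiable. -/
def theorySatLanguage (𝔗 : AbstractTheory T) : Set (List (Option ΓT)) :=
  {w | ∃ l : List T, w = atomListCode encT l ∧ {s | s ∈ l} ∈ 𝔗.Sat}

end Codes

/-! ## Nondeterministic oracle machines and `NP` relative to an oracle -/

/-- The stacks of a machine: the input stack, the query stack and work stacks. -/
inductive Stk (K : Type) where
  | input
  | query
  | work (k : K)
  deriving DecidableEq

/-- The alphabet of each stack. -/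
@[reducible] def Stk.Alphabet {K : Type} (I Q : Type) (Γ : K → Type) : Stk K → Type
  | .input => I
  | .query => Q
  | .work k => Γ k

/-- A nondeterministic Turing machine (Mathlib's multi-stack model `Turing.TM2`, where two stacks
form a tape) with input alphabet `I` and an oracle for a set of strings over `Q`.
It has finitely many labels, internal states and stacks; as in `Turing.FinTM2`, no finiteness needs
to be asked of the alphabets of the work stacks, which are empty at the start: a finite program
with finitely many internal states can only ever push finitely many symbols. -/
structure OracleNTM (I Q : Type) where
  /-- The index type of the work stacks. -/
  K : Type
  [decK : DecidableEq K]
  [finK : Fintype K]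
  /-- The alphabets of the work stacks. -/
  Γ : K → Type
  /-- The labels. -/
  Λ : Type
  [finΛ : Fintype Λ]
  /-- The internal states. -/
  σ : Type
  [finσ : Fintype σ]
  /-- The initial label. -/
  main : Λ
  /-- The initial internal state. -/
  init : σ
  /-- The program: for each label, the two statements between which the machine chooses
  nondeterministically (they may coincide). -/
  program : Bool → Λ → Turing.TM2.Stmt (Stk.Alphabet I Q Γ) Λ σ
  /-- Query labels are those with value `some (yes, no)`: there, the oracle is asked about the
  string on the query stack, and the machine goes on at label `yes` or `no`. -/
  query : Λ → Option (Λ × Λ)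
  /-- The internal states in which a halted machine accepts. -/
  accept : σ → Bool

namespace OracleNTM

attribute [instance] OracleNTM.decK OracleNTM.finK OracleNTM.finΛ OracleNTM.finσ

variable {I Q : Type} (M : OracleNTM I Q) (O : Set (List Q))

/-- Configurations; the label `none` means that the machine has halted. -/
abbrev Cfg : Type := Turing.TM2.Cfg (Stk.Alphabet I Q M.Γ) M.Λ M.σ

/-- The initial configuration on input `w`: all stacks but the input stack are empty. The first
symbol of `w` is on the top. -/
def initCfg (w : List I) : M.Cfg where
  l := some M.main
  var := M.init
  stk := fun k => match k with
    | .input => w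
    | .query => []
    | .work _ => []

/-- One step of the machine with oracle `O`; a query takes a single step. -/
inductive Step : M.Cfg → M.Cfg → Prop
  | move (b : Bool) (l : M.Λ) (v : M.σ) (S : ∀ k, List (Stk.Alphabet I Q M.Γ k))
      (hq : M.query l = none) :
      Step ⟨some l, v, S⟩ (Turing.TM2.stepAux (M.program b l) v S)
  | queryYes (l yes no : M.Λ) (v : M.σ) (S : ∀ k, List (Stk.Alphabet I Q M.Γ k))
      (hq : M.query l = some (yes, no)) (hO : S .query ∈ O) :
      Step ⟨some l, v, S⟩ ⟨some yes, v, S⟩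
  | queryNo (l yes no : M.Λ) (v : M.σ) (S : ∀ k, List (Stk.Alphabet I Q M.Γ k))
      (hq : M.query l = some (yes, no)) (hO : S .query ∉ O) :
      Step ⟨some l, v, S⟩ ⟨some no, v, S⟩

/-- `Steps n c d`: some computation path leads from `c` to `d` in exactly `n` steps. -/
inductive Steps : ℕ → M.Cfg → M.Cfg → Prop
  | refl (c : M.Cfg) : Steps 0 c c
  | tail (n : ℕ) (c d e : M.Cfg) : Steps n c d → M.Step O d e → Steps (n + 1) c e

/-- The machine accepts `w` if some computation path on `w` halts in an accepting state. -/
def Accepts (w : List I) : Prop :=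
  ∃ n c, M.Steps O n (M.initCfg w) c ∧ c.l = none ∧ M.accept c.var = true

/-- Every computation path on `w` has at most `n` steps (in particular, every path halts). -/
def HaltsWithin (w : List I) (n : ℕ) : Prop :=
  ∀ m c, M.Steps O m (M.initCfg w) c → m ≤ n

end OracleNTM

/-- The decision problem with instances `ι`, written as strings by `code`, and yes-instances `yes`
is in `NP` relative to the oracle `O`: some nondeterministic machine with oracle `O` decides it in
polynomial time. (A set of strings `L` is the case `ι = List I`, `code = id`, `yes = (· ∈ L)`.) -/
def InNPOracle {I Q : Type} [Finite I] [Finite Q] (O : Set (List Q)) {ι : Type*}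
    (code : ι → List I) (yes : ι → Prop) : Prop :=
  ∃ (M : OracleNTM I Q) (p : Polynomial ℕ), ∀ i : ι,
    M.HaltsWithin O (code i) (p.eval (code i).length) ∧ (M.Accepts O (code i) ↔ yes i)

/-! A stable model contains `s` or its complement for every `s ∈ E`, so it may be infinite and
cannot be guessed as a whole. What matters is the truth of the body literals, and there are at most
as many of them as symbols in the program. One bit is guessed per literal occurrence. With negative
literals evaluated by their bits the program becomes definite; with the theory atoms guessed true
added as facts, it has a least closed set `S` (`IsDerivedSet`), which forward chaining reaches after
as many rounds as there are rules. The guess is accepted if the bits agree with `S`, `⊥` is not in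
`S`, and the oracle accepts the theory atoms in `S` together with the complements of those guessed
false (`verifierAccepts_iff`). `E` is never read: theory atoms in bodies are external by assumption.

Soundness (`satisfiable_of_verifierAccepts`): let the assignment `v` satisfy the queried set, and
let `Y` be `S` together with all external atoms true under `v`. By the absolute complement exactly
one of `s` and its complement is true under `v`, so the disjunctions for `E` force every model `H ⊆
Y` of the reduct to contain all external atoms true under `v`. Hence `H` contains the guessed facts,
and being closed under the rules it contains `S`; so `H = Y`. The query makes `Y` and `S` agree on
body atoms, so the bits are also correct for `Y`.

Completeness (`exists_verifierAccepts`): read the bits off a stable model `Y`. Then `S ⊆ Y`, because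
`Y` is closed under the rules. The atoms of `Y` that are external or in `S` form a model of the
reduct, so by minimality they are all of `Y`. Thus all body atoms of `Y` lie in `S`, and the queried
set is part of `Y`.

The verifier is an explicit multi-stack program. Its fragments are specified by continuations
(`Frag.Runs`): whatever the surrounding machine decides from the exit within `n` steps, it decides
from the entry within `n + t`. This carries time and acceptance together, while nondeterminism is
confined to one initial loop (`decides_guess`). A pass over the program string acts as a fold over
the rules (`Handles.runs_pass`), so that `runs_verifier` reduces machine correctness to facts about
lists. Each pass adds at most the length of the program to the derived list, the number of rounds is
that length, and a computed complement is no longer than its computation permits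
(`length_output_le`); hence the time is polynomial. -/

open Turing.TM2

/-! ## Computation trees of a transition relation -/

section Trees

variable {C : Type*} (R : C → C → Prop) (acc : C → Prop)

/-- `RelPath R n c d`: some path of `R` leads from `c` to `d` in exactly `n` steps. -/
inductive RelPath : ℕ → C → C → Prop
  | refl (c : C) : RelPath 0 c c
  | head {n : ℕ} {c d e : C} : R c d → RelPath n d e → RelPath (n + 1) c e

/-- All paths from `c` have at most `n` steps, and some path leads to an accepting configuration
iff `b` holds. -/
structure Decides (c : C) (n : ℕ) (b : Prop) : Prop where
  bounded : ∀ m d, RelPath R m c d → m ≤ n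
  accepts : (∃ m d, RelPath R m c d ∧ acc d) ↔ b

variable {R acc}

theorem Decides.mono {c : C} {n n' : ℕ} {b : Prop} (h : Decides R acc c n b) (hn : n ≤ n') :
    Decides R acc c n' b :=
  ⟨fun m d hm => (h.bounded m d hm).trans hn, h.accepts⟩

theorem Decides.congr {c : C} {n : ℕ} {b b' : Prop} (h : Decides R acc c n b) (hb : b ↔ b') :
    Decides R acc c n b' :=
  ⟨h.bounded, h.accepts.trans hb⟩

theorem Decides.halted {c : C} (h : ∀ d, ¬ R c d) : Decides R acc c 0 (acc c) := by
  have key : ∀ m d, RelPath R m c d → m = 0 ∧ d = c := by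
    intro m d hm
    cases hm with
    | refl => exact ⟨rfl, rfl⟩
    | head h1 _ => exact absurd h1 (h _)
  refine ⟨fun m d hm => (key m d hm).1.le, ?_, fun hc => ⟨0, c, .refl c, hc⟩⟩
  rintro ⟨m, d, hm, hd⟩
  rwa [(key m d hm).2] at hd

/-- Since `c` itself does not accept, an accepting path starts with a step to some `c' i`. This is
how a guess becomes an existential quantifier. -/
theorem Decides.choice {ι : Type*} {c : C} {c' : ι → C} {n : ℕ} {b : ι → Prop}
    (hR : ∀ d, R c d ↔ ∃ i, d = c' i) (hc : ¬ acc c) (h : ∀ i, Decides R acc (c' i) n (b i)) :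
    Decides R acc c (n + 1) (∃ i, b i) := by
  constructor
  · intro m d hm
    cases hm with
    | refl => exact Nat.zero_le _
    | head h1 h2 =>
      obtain ⟨i, rfl⟩ := (hR _).1 h1
      exact Nat.succ_le_succ ((h i).bounded _ _ h2)
  · constructor
    · rintro ⟨m, d, hm, hd⟩
      cases hm with
      | refl => exact absurd hd hc
      | head h1 h2 =>
        obtain ⟨i, rfl⟩ := (hR _).1 h1
        exact ⟨i, (h i).accepts.1 ⟨_, _, h2, hd⟩⟩
    · rintro ⟨i, hi⟩
      obtain ⟨m, d, hm, hd⟩ := (h i).accepts.2 hi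
      exact ⟨m + 1, d, .head ((hR _).2 ⟨i, rfl⟩) hm, hd⟩

theorem Decides.step {c c' : C} {n : ℕ} {b : Prop} (hR : ∀ d, R c d ↔ d = c') (hc : ¬ acc c)
    (h : Decides R acc c' n b) : Decides R acc c (n + 1) b :=
  (Decides.choice (ι := Unit) (c' := fun _ => c') (b := fun _ => b) (by simpa using hR) hc
    fun _ => h).congr (by simp)

end Trees

/-! ## Program fragments -/

section Fragments

variable {κ : Type} [DecidableEq κ] {Γ : κ → Type} {σ : Type}

/-- Renames the labels of a statement by `e`, and replaces halting by a jump to `x` (if given). -/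
def Turing.TM2.Stmt.link {Λ Λ' : Type} (e : Λ → Λ') (x : Option Λ') : Stmt Γ Λ σ → Stmt Γ Λ' σ
  | .push k f q => .push k f (q.link e x)
  | .peek k f q => .peek k f (q.link e x)
  | .pop k f q => .pop k f (q.link e x)
  | .load f q => .load f (q.link e x)
  | .branch f q₁ q₂ => .branch f (q₁.link e x) (q₂.link e x)
  | .goto f => .goto fun v => e (f v)
  | .halt => match x with
    | none => .halt
    | some y => .goto fun _ => y

/-- Labels do not influence the data within a step, so only the label of the result has to be
translated. -/
theorem Turing.TM2.stepAux_link {Λ Λ' : Type} (e : Λ → Λ') (x : Option Λ') (q : Stmt Γ Λ σ)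
    (v : σ) (S : ∀ k, List (Γ k)) :
    stepAux (q.link e x) v S =
      ⟨(stepAux q v S).l.elim x (fun l => some (e l)), (stepAux q v S).var,
        (stepAux q v S).stk⟩ := by
  induction q generalizing v S with
  | branch f q₁ q₂ h₁ h₂ => cases h : f v <;> simp [Stmt.link, stepAux, h, h₁, h₂]
  | halt => cases x <;> simp [Stmt.link, stepAux]
  | _ => simp_all [Stmt.link, stepAux]

/-- Pushes `f v` if it is defined, and does nothing otherwise. -/
noncomputable def Turing.TM2.Stmt.pushOption {Λ : Type} (k : κ) (f : σ → Option (Γ k))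
    (q : Stmt Γ Λ σ) : Stmt Γ Λ σ :=
  open Classical in
  if h : Nonempty (Γ k) then
    .branch (fun v => (f v).isSome) (.push k (fun v => (f v).getD h.some) q) q
  else q

@[simp] theorem Turing.TM2.stepAux_pushOption {Λ : Type} (k : κ) (f : σ → Option (Γ k))
    (q : Stmt Γ Λ σ) (v : σ) (S : ∀ k, List (Γ k)) :
    stepAux (q.pushOption k f) v S =
      stepAux q v (Function.update S k ((f v).toList ++ S k)) := by
  unfold Stmt.pushOption
  split_ifs with h
  · cases hv : f v <;> simp [stepAux, hv]
  · cases hv : f v with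
    | none => simp
    | some x => exact absurd ⟨x⟩ h

/-- A deterministic program fragment, which may ask an oracle. Halting is the exit of the
fragment. -/
structure Frag (Γ : κ → Type) (σ : Type) where
  Lab : Type
  [fin : Fintype Lab]
  entry : Lab
  code : Lab → Stmt Γ Lab σ
  query : Lab → Option (Lab × Lab)

attribute [instance] Frag.fin

variable (ask : (∀ k, List (Γ k)) → Prop)

open Classical in
/-- The configuration after one step of a fragment. -/
noncomputable def Frag.next (F : Frag Γ σ) (l : F.Lab) (v : σ) (S : ∀ k, List (Γ k)) :
    Cfg Γ F.Lab σ :=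
  match F.query l with
  | none => stepAux (F.code l) v S
  | some (y, n) => ⟨some (if ask S then y else n), v, S⟩

/-- A configuration of a fragment as a configuration of a machine that contains it. -/
def Turing.TM2.Cfg.embed {Λ Λ' : Type} (e : Λ → Λ') (x : Λ') (c : Cfg Γ Λ σ) : Cfg Γ Λ' σ :=
  ⟨some (c.l.elim x e), c.var, c.stk⟩

/-- The transition relation `R` contains the fragment `F` at the labels `e`, with exit to `x`. -/
def Frag.Linked (F : Frag Γ σ) {Λ : Type} (R : Cfg Γ Λ σ → Cfg Γ Λ σ → Prop)
    (acc : Cfg Γ Λ σ → Prop) (e : F.Lab → Λ) (x : Λ) : Prop :=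
  ∀ l v S, ¬ acc ⟨some (e l), v, S⟩ ∧
    ∀ d, R ⟨some (e l), v, S⟩ d ↔ d = (F.next ask l v S).embed e x

/-- Started in the state `s`, the fragment exits in the state `s'` after at most `t` steps. -/
def Frag.Runs (F : Frag Γ σ) (s : σ × ∀ k, List (Γ k)) (t : ℕ) (s' : σ × ∀ k, List (Γ k)) :
    Prop :=
  ∀ (Λ : Type) (R : Cfg Γ Λ σ → Cfg Γ Λ σ → Prop) (acc : Cfg Γ Λ σ → Prop) (e : F.Lab → Λ) (x : Λ),
    F.Linked ask R acc e x → ∀ n b, Decides R acc ⟨some x, s'.1, s'.2⟩ n b →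
      Decides R acc ⟨some (e F.entry), s.1, s.2⟩ (n + t) b

variable {ask}

theorem Frag.Runs.mono {F : Frag Γ σ} {s s' : σ × ∀ k, List (Γ k)} {t t' : ℕ}
    (h : F.Runs ask s t s') (ht : t ≤ t') : F.Runs ask s t' s' :=
  fun Λ R acc e x hl n b hd => (h Λ R acc e x hl n b hd).mono (by omega)

theorem Frag.Runs.cast {F : Frag Γ σ} {s s' s₁ s₁' : σ × ∀ k, List (Γ k)} {t t' : ℕ}
    (h : F.Runs ask s t s') (hs : s = s₁) (hs' : s' = s₁') (ht : t ≤ t') :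
    F.Runs ask s₁ t' s₁' := by
  subst hs hs'
  exact h.mono ht

theorem Frag.Linked.step {F : Frag Γ σ} {Λ : Type} {R : Cfg Γ Λ σ → Cfg Γ Λ σ → Prop}
    {acc : Cfg Γ Λ σ → Prop} {e : F.Lab → Λ} {x : Λ} (h : F.Linked ask R acc e x)
    {l : F.Lab} {v : σ} {S : ∀ k, List (Γ k)} {n : ℕ} {b : Prop}
    (hd : Decides R acc ((F.next ask l v S).embed e x) n b) :
    Decides R acc ⟨some (e l), v, S⟩ (n + 1) b :=
  .step (h l v S).2 (h l v S).1 hd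

/-- A single statement without jumps. -/
def Frag.basic (q : Stmt Γ Empty σ) : Frag Γ σ where
  Lab := Unit
  entry := ()
  code _ := q.link Empty.elim none
  query _ := none

theorem Frag.runs_basic {q : Stmt Γ Empty σ} {v v' : σ} {S S' : ∀ k, List (Γ k)}
    (h : stepAux q v S = ⟨none, v', S'⟩) : (Frag.basic q).Runs ask (v, S) 1 (v', S') := by
  intro Λ R acc e x hl n b hd
  have hn : (Frag.basic q).next ask () v S = ⟨none, v', S'⟩ := by
    simp [Frag.next, Frag.basic, stepAux_link, h]
  exact hl.step (hn ▸ hd)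

/-- Sequential composition. -/
def Frag.seq (F G : Frag Γ σ) : Frag Γ σ where
  Lab := F.Lab ⊕ G.Lab
  entry := .inl F.entry
  code
    | .inl l => (F.code l).link .inl (some (.inr G.entry))
    | .inr l => (G.code l).link .inr none
  query
    | .inl l => (F.query l).map fun p => (.inl p.1, .inl p.2)
    | .inr l => (G.query l).map fun p => (.inr p.1, .inr p.2)

/-- A machine that contains the composition contains `F` with its exit at the entry of `G`, and `G`
with exit `x`. So what `G` guarantees is the continuation that `F` needs. -/
theorem Frag.Runs.seq {F G : Frag Γ σ} {s s' s'' : σ × ∀ k, List (Γ k)} {t t' : ℕ}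
    (hF : F.Runs ask s t s') (hG : G.Runs ask s' t' s'') :
    (F.seq G).Runs ask s (t + t') s'' := by
  intro Λ R acc e x hl n b hd
  have h1 : F.Linked ask R acc (e ∘ Sum.inl) (e (.inr G.entry)) := by
    intro l v S
    refine ⟨(hl (.inl l) v S).1, fun d => ((hl (.inl l) v S).2 d).trans ?_⟩
    unfold Frag.next Frag.seq Cfg.embed
    rcases hq : F.query l with _ | ⟨y, n⟩
    · simp only [hq, Option.map_none, stepAux_link]
      cases (stepAux (F.code l) v S).l <;> rfl
    · simp only [hq, Option.map_some]
      split_ifs <;> rfl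
  have h2 : G.Linked ask R acc (e ∘ Sum.inr) x := by
    intro l v S
    refine ⟨(hl (.inr l) v S).1, fun d => ((hl (.inr l) v S).2 d).trans ?_⟩
    unfold Frag.next Frag.seq Cfg.embed
    rcases hq : G.query l with _ | ⟨y, n⟩
    · simp only [hq, Option.map_none, stepAux_link]
      cases (stepAux (G.code l) v S).l <;> rfl
    · simp only [hq, Option.map_some]
      split_ifs <;> rfl
  exact (hF _ R acc _ _ h1 _ b (hG _ R acc _ _ h2 n b hd)).mono (by omega)

/-- Branching on the internal state. -/
def Frag.ite (p : σ → Bool) (F G : Frag Γ σ) : Frag Γ σ where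
  Lab := Option (F.Lab ⊕ G.Lab)
  entry := none
  code
    | none => .goto fun v => some (cond (p v) (.inl F.entry) (.inr G.entry))
    | some (.inl l) => (F.code l).link (fun l => some (.inl l)) none
    | some (.inr l) => (G.code l).link (fun l => some (.inr l)) none
  query
    | none => none
    | some (.inl l) => (F.query l).map fun p => (some (.inl p.1), some (.inl p.2))
    | some (.inr l) => (G.query l).map fun p => (some (.inr p.1), some (.inr p.2))

theorem Frag.Runs.ite_true {p : σ → Bool} {F G : Frag Γ σ} {s s' : σ × ∀ k, List (Γ k)} {t : ℕ}
    (hp : p s.1 = true) (hF : F.Runs ask s t s') : (Frag.ite p F G).Runs ask s (t + 1) s' := by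
  intro Λ R acc e x hl n b hd
  have h1 : F.Linked ask R acc (fun l => e (some (.inl l))) x := by
    intro l v S
    refine ⟨(hl (some (.inl l)) v S).1, fun d => ((hl (some (.inl l)) v S).2 d).trans ?_⟩
    unfold Frag.next Frag.ite Cfg.embed
    rcases hq : F.query l with _ | ⟨y, n⟩
    · simp only [hq, Option.map_none, stepAux_link]
      cases (stepAux (F.code l) v S).l <;> rfl
    · simp only [hq, Option.map_some]
      split_ifs <;> rfl
  have hn : (Frag.ite p F G).next ask none s.1 s.2 = ⟨some (some (.inl F.entry)), s.1, s.2⟩ := by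
    simp [Frag.next, Frag.ite, stepAux, hp]
  exact (hl.step (l := none) (n := n + t) (hn ▸ hF _ R acc _ _ h1 n b hd)).mono (by omega)

theorem Frag.Runs.ite_false {p : σ → Bool} {F G : Frag Γ σ} {s s' : σ × ∀ k, List (Γ k)} {t : ℕ}
    (hp : p s.1 = false) (hG : G.Runs ask s t s') : (Frag.ite p F G).Runs ask s (t + 1) s' := by
  intro Λ R acc e x hl n b hd
  have h1 : G.Linked ask R acc (fun l => e (some (.inr l))) x := by
    intro l v S
    refine ⟨(hl (some (.inr l)) v S).1, fun d => ((hl (some (.inr l)) v S).2 d).trans ?_⟩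
    unfold Frag.next Frag.ite Cfg.embed
    rcases hq : G.query l with _ | ⟨y, n⟩
    · simp only [hq, Option.map_none, stepAux_link]
      cases (stepAux (G.code l) v S).l <;> rfl
    · simp only [hq, Option.map_some]
      split_ifs <;> rfl
  have hn : (Frag.ite p F G).next ask none s.1 s.2 = ⟨some (some (.inr G.entry)), s.1, s.2⟩ := by
    simp [Frag.next, Frag.ite, stepAux, hp]
  exact (hl.step (l := none) (n := n + t) (hn ▸ hG _ R acc _ _ h1 n b hd)).mono (by omega)

/-- A loop: the statement `q` is executed; then the loop ends if `q` halts, restarts if `q` jumps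
to `false`, and restarts after an execution of `F` if `q` jumps to `true`. -/
def Frag.loop (q : Stmt Γ Bool σ) (F : Frag Γ σ) : Frag Γ σ where
  Lab := Option F.Lab
  entry := none
  code
    | none => q.link (fun b => cond b (some F.entry) none) none
    | some l => (F.code l).link some (some none)
  query
    | none => none
    | some l => (F.query l).map fun p => (some p.1, some p.2)

theorem Frag.runs_loop_exit {q : Stmt Γ Bool σ} {F : Frag Γ σ} {v v' : σ}
    {S S' : ∀ k, List (Γ k)} (h : stepAux q v S = ⟨none, v', S'⟩) :
    (Frag.loop q F).Runs ask (v, S) 1 (v', S') := by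
  intro Λ R acc e x hl n b hd
  have hn : (Frag.loop q F).next ask none v S = ⟨none, v', S'⟩ := by
    simp [Frag.next, Frag.loop, stepAux_link, h]
  exact hl.step (l := none) (hn ▸ hd)

theorem Frag.runs_loop_continue {q : Stmt Γ Bool σ} {F : Frag Γ σ} {v v' : σ}
    {S S' : ∀ k, List (Γ k)} {s : σ × ∀ k, List (Γ k)} {t : ℕ}
    (h : stepAux q v S = ⟨some false, v', S'⟩) (hs : (Frag.loop q F).Runs ask (v', S') t s) :
    (Frag.loop q F).Runs ask (v, S) (t + 1) s := by
  intro Λ R acc e x hl n b hd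
  have hn : (Frag.loop q F).next ask none v S = ⟨some none, v', S'⟩ := by
    simp [Frag.next, Frag.loop, stepAux_link, h]
  exact (hl.step (l := none) (n := n + t) (hn ▸ hs _ R acc e x hl n b hd)).mono (by omega)

/-- The body is linked with its exit at the head of the loop, so the remaining iterations serve as
its continuation. -/
theorem Frag.runs_loop_body {q : Stmt Γ Bool σ} {F : Frag Γ σ} {v v' : σ}
    {S S' : ∀ k, List (Γ k)} {s₁ s₂ : σ × ∀ k, List (Γ k)} {t₁ t₂ : ℕ}
    (h : stepAux q v S = ⟨some true, v', S'⟩) (h₁ : F.Runs ask (v', S') t₁ s₁)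
    (h₂ : (Frag.loop q F).Runs ask s₁ t₂ s₂) :
    (Frag.loop q F).Runs ask (v, S) (t₁ + t₂ + 1) s₂ := by
  intro Λ R acc e x hl n b hd
  have hF : F.Linked ask R acc (fun l => e (some l)) (e none) := by
    intro l v S
    refine ⟨(hl (some l) v S).1, fun d => ((hl (some l) v S).2 d).trans ?_⟩
    unfold Frag.next Frag.loop Cfg.embed
    rcases hq : F.query l with _ | ⟨y, n⟩
    · simp only [hq, Option.map_none, stepAux_link]
      cases (stepAux (F.code l) v S).l <;> rfl
    · simp only [hq, Option.map_some]
      split_ifs <;> rfl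
  have hn : (Frag.loop q F).next ask none v S = ⟨some (some F.entry), v', S'⟩ := by
    simp [Frag.next, Frag.loop, stepAux_link, h]
  exact (hl.step (l := none) (n := n + t₂ + t₁)
    (hn ▸ h₁ _ R acc _ _ hF _ b (h₂ _ R acc e x hl n b hd))).mono (by omega)

/-- The fragment that does nothing. -/
def Frag.skip : Frag Γ σ := Frag.basic .halt

/-- Asks the oracle and records the answer in the internal state. -/
def Frag.askOracle (f : Bool → σ → σ) : Frag Γ σ where
  Lab := Option Bool
  entry := none
  code
    | none => .halt
    | some b => .load (f b) .halt
  query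
    | none => some (some true, some false)
    | some _ => none

-- A query only selects a label; the second step turns this label into a register value.
open Classical in
theorem Frag.runs_askOracle {f : Bool → σ → σ} {v : σ} {S : ∀ k, List (Γ k)} :
    (Frag.askOracle f).Runs ask (v, S) 2 (f (decide (ask S)) v, S) := by
  intro Λ R acc e x hl n b hd
  have hn : (Frag.askOracle f).next ask none v S = ⟨some (some (decide (ask S))), v, S⟩ := by
    by_cases hS : ask S <;> simp [Frag.next, Frag.askOracle, hS]
  have hn' : (Frag.askOracle f).next ask (some (decide (ask S))) v S =
      ⟨none, f (decide (ask S)) v, S⟩ := by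
    simp [Frag.next, Frag.askOracle, stepAux]
  exact hl.step (l := none) (n := n + 1) (hn ▸ hl.step (hn' ▸ hd))

end Fragments

/-! ## Machines from fragments -/

section Machine

variable {I Q K : Type} [DecidableEq K] [Fintype K] {Γ : K → Type} {σ : Type} [Fintype σ]

/-- The string on the query stack belongs to `O`. -/
def Stk.Asks (O : Set (List Q)) (S : ∀ k, List (Stk.Alphabet I Q Γ k)) : Prop :=
  S .query ∈ O

/-- The machine that iterates the statements `g`, between which it chooses nondeterministically,
as long as they jump to `true`; then runs the fragment `F`; and then halts. -/
@[reducible] def Frag.toMachine (F : Frag (Stk.Alphabet I Q Γ) σ)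
    (g : Bool → Stmt (Stk.Alphabet I Q Γ) Bool σ) (init : σ) (accept : σ → Bool) :
    OracleNTM I Q where
  K := K
  Γ := Γ
  Λ := F.Lab ⊕ Bool
  σ := σ
  main := .inr true
  init := init
  program b
    | .inl l => (F.code l).link .inl (some (.inr false))
    | .inr true => (g b).link (fun c => cond c (.inr true) (.inl F.entry)) none
    | .inr false => .halt
  query
    | .inl l => (F.query l).map fun p => (.inl p.1, .inl p.2)
    | .inr _ => none
  accept := accept

variable {F : Frag (Stk.Alphabet I Q Γ) σ} {g : Bool → Stmt (Stk.Alphabet I Q Γ) Bool σ}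
  {init : σ} {accept : σ → Bool} {O : Set (List Q)}

theorem OracleNTM.step_iff_of_query_eq_none {M : OracleNTM I Q} {l : M.Λ} (h : M.query l = none)
    (v : M.σ) (S : ∀ k, List (Stk.Alphabet I Q M.Γ k)) (d : M.Cfg) :
    M.Step O ⟨some l, v, S⟩ d ↔ ∃ b, d = stepAux (M.program b l) v S := by
  constructor
  · intro hd
    cases hd with
    | move b => exact ⟨b, rfl⟩
    | queryYes _ y n _ _ hq => simp [h] at hq
    | queryNo _ y n _ _ hq => simp [h] at hq
  · rintro ⟨b, rfl⟩
    exact .move b l v S h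

open Classical in
theorem OracleNTM.step_iff_of_query_eq_some {M : OracleNTM I Q} {l y n : M.Λ}
    (h : M.query l = some (y, n)) (v : M.σ) (S : ∀ k, List (Stk.Alphabet I Q M.Γ k))
    (d : M.Cfg) :
    M.Step O ⟨some l, v, S⟩ d ↔ d = ⟨some (if S .query ∈ O then y else n), v, S⟩ := by
  constructor
  · intro hd
    cases hd with
    | move b _ _ _ hq => simp [h] at hq
    | queryYes _ y' n' _ _ hq hO => simp_all
    | queryNo _ y' n' _ _ hq hO => simp_all
  · rintro rfl
    split_ifs with hO
    · exact .queryYes l y n v S h hO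
    · exact .queryNo l y n v S h hO

theorem OracleNTM.step_halted {M : OracleNTM I Q} {c d : M.Cfg} (h : c.l = none) :
    ¬ M.Step O c d := by
  intro hd
  cases hd <;> simp at h

theorem OracleNTM.Steps.trans_step {M : OracleNTM I Q} {n : ℕ} {c d e : M.Cfg}
    (h : M.Step O c d) (h' : M.Steps O n d e) : M.Steps O (n + 1) c e := by
  induction h' with
  | refl => exact .tail 0 _ _ _ (.refl _) h
  | tail n c d e _ hs ih => exact .tail _ _ _ _ (ih h) hs

/-- `Steps` grows at the end and `RelPath` at the start; the latter suits reasoning backwards from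
exits. -/
theorem OracleNTM.steps_iff_relPath {M : OracleNTM I Q} {n : ℕ} {c d : M.Cfg} :
    M.Steps O n c d ↔ RelPath (M.Step O) n c d := by
  constructor
  · have snoc : ∀ {n : ℕ} {c d e : M.Cfg}, RelPath (M.Step O) n c d → M.Step O d e →
        RelPath (M.Step O) (n + 1) c e := by
      intro n c d e h he
      induction h with
      | refl => exact .head he (.refl _)
      | head h1 _ ih => exact .head h1 (ih he)
    intro h
    induction h with
    | refl => exact .refl _
    | tail n c d e _ hs ih => exact snoc ih hs
  · intro h
    induction h with
    | refl => exact .refl _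
    | head h1 _ ih => exact ih.trans_step h1

/-- The accepting configurations of a machine. -/
def OracleNTM.AcceptCfg (M : OracleNTM I Q) (c : M.Cfg) : Prop :=
  c.l = none ∧ M.accept c.var = true

theorem Decides.haltsWithin_and_accepts_iff {M : OracleNTM I Q} {w : List I} {n : ℕ} {b : Prop}
    (h : Decides (M.Step O) M.AcceptCfg (M.initCfg w) n b) :
    M.HaltsWithin O w n ∧ (M.Accepts O w ↔ b) :=
  ⟨fun m c hm => h.bounded m c (OracleNTM.steps_iff_relPath.1 hm),
    (exists_congr fun _ => exists_congr fun _ =>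
      and_congr_left fun _ => OracleNTM.steps_iff_relPath).trans h.accepts⟩

theorem Frag.linked_toMachine :
    F.Linked (Stk.Asks O) ((F.toMachine g init accept).Step O)
      (F.toMachine g init accept).AcceptCfg Sum.inl (.inr false) := by
  intro l v S
  refine ⟨fun h => by simpa using h.1, fun d => ?_⟩
  unfold Frag.next Cfg.embed
  rcases hq : F.query l with _ | ⟨y, n⟩
  · rw [OracleNTM.step_iff_of_query_eq_none (by simp [hq])]
    simp only [stepAux_link, exists_const]
    cases (stepAux (F.code l) v S).l <;> simp
  · rw [OracleNTM.step_iff_of_query_eq_some (y := Sum.inl y) (n := Sum.inl n) (by simp [hq])]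
    by_cases h : S Stk.query ∈ O <;> simp [Stk.Asks, h]

/-- The exit of `F` is the label `.inr false`, which halts at once. This accounts for the extra step
and provides the first continuation. -/
theorem Frag.Runs.decides_toMachine {s s' : σ × ∀ k, List (Stk.Alphabet I Q Γ k)} {t : ℕ}
    (h : F.Runs (Stk.Asks O) s t s') :
    Decides ((F.toMachine g init accept).Step O) (F.toMachine g init accept).AcceptCfg
      ⟨some (.inl F.entry), s.1, s.2⟩ (t + 1) (accept s'.1 = true) := by
  refine (h _ _ _ _ _ Frag.linked_toMachine 1 _ ?_).mono (by omega)
  refine Decides.step (c' := ⟨none, s'.1, s'.2⟩) (fun d => ?_) (fun h => by simpa using h.1) ?_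
  · rw [OracleNTM.step_iff_of_query_eq_none (by rfl)]
    simp [stepAux]
  · exact (Decides.halted fun d => OracleNTM.step_halted rfl).congr
      (by simp [OracleNTM.AcceptCfg])

theorem Frag.toMachine_guess_step {v : σ} {S : ∀ k, List (Stk.Alphabet I Q Γ k)} {n : ℕ}
    {p : Bool → Prop}
    (h : ∀ b, Decides ((F.toMachine g init accept).Step O) (F.toMachine g init accept).AcceptCfg
      (stepAux ((g b).link (fun c => cond c (.inr true) (.inl F.entry)) none) v S) n (p b)) :
    Decides ((F.toMachine g init accept).Step O) (F.toMachine g init accept).AcceptCfg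
      ⟨some (.inr true), v, S⟩ (n + 1) (∃ b, p b) := by
  refine Decides.choice (fun d => ?_) (fun h => by simpa using h.1) h
  exact OracleNTM.step_iff_of_query_eq_none (M := F.toMachine g init accept) rfl v S d

end Machine

/-! ## The stacks and registers of the verifier -/

section Verifier

/-- The stacks for symbols of programs. -/
inductive WorkStack where
  | prog
  | progRead
  | clock
  | name
  | nameRead
  | scratch
  | derived
  | derivedRead
  deriving DecidableEq

instance : Fintype WorkStack :=
  ⟨{.prog, .progRead, .clock, .name, .nameRead, .scratch, .derived, .derivedRead}, fun a => by
    cases a <;> simp⟩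

/-- The symbols on the work stacks: symbols of programs with a truth value, which is used for the
marks of body literals. -/
abbrev WorkSym (ΓA ΓT : Type) : Type := ProgSym ΓA ΓT × Bool

/-- The alphabets of the work stacks, together with those of a subroutine. -/
@[reducible] def workAlphabet {K' : Type} (ΓA ΓT : Type) (Γ' : K' → Type) :
    WorkStack ⊕ K' → Type
  | .inl _ => WorkSym ΓA ΓT
  | .inr k => Γ' k

/-- All alphabets. -/
abbrev verifierAlphabet {K' : Type} (ΓA ΓT : Type) (Γ' : K' → Type) :
    Stk (WorkStack ⊕ K') → Type :=
  Stk.Alphabet (ProgSym ΓA ΓT) (Option ΓT) (workAlphabet ΓA ΓT Γ')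

/-- The registers; `sub` is the internal state of a subroutine. -/
@[ext] structure Registers (ΓA ΓT τ : Type) where
  cur : Option (WorkSym ΓA ΓT)
  fst : Option (WorkSym ΓA ΓT)
  snd : Option (WorkSym ΓA ΓT)
  diff : Bool
  found : Bool
  applicable : Bool
  reject : Bool
  answer : Bool
  sub : τ

instance {ΓA ΓT τ : Type} [Finite ΓA] [Finite ΓT] [Finite τ] : Finite (Registers ΓA ΓT τ) :=
  Finite.of_injective (fun r => (r.cur, r.fst, r.snd, r.diff, r.found, r.applicable, r.reject,
    r.answer, r.sub)) (by
      intro r r' h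
      simp only [Prod.mk.injEq] at h
      obtain ⟨h1, h2, h3, h4, h5, h6, h7, h8, h9⟩ := h
      exact Registers.ext h1 h2 h3 h4 h5 h6 h7 h8 h9)

variable {ΓA ΓT K' τ : Type} [DecidableEq K'] {Γ' : K' → Type}

/-- The contents of all stacks. -/
def tapes (inp : List (ProgSym ΓA ΓT)) (qry : List (Option ΓT))
    (w : WorkStack → List (WorkSym ΓA ΓT)) (u : ∀ k, List (Γ' k)) :
    ∀ k, List (verifierAlphabet ΓA ΓT Γ' k)
  | .input => inp
  | .query => qry
  | .work (.inl a) => w a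
  | .work (.inr k) => u k

section StackLemmas

variable (inp : List (ProgSym ΓA ΓT)) (qry : List (Option ΓT))
  (w : WorkStack → List (WorkSym ΓA ΓT)) (u : ∀ k, List (Γ' k))

omit [DecidableEq K'] in
@[simp] theorem tapes_input : tapes inp qry w u .input = inp := rfl
omit [DecidableEq K'] in
@[simp] theorem tapes_query : tapes inp qry w u .query = qry := rfl
omit [DecidableEq K'] in
@[simp] theorem tapes_work (a : WorkStack) : tapes inp qry w u (.work (.inl a)) = w a := rfl
omit [DecidableEq K'] in
@[simp] theorem tapes_sub (k : K') : tapes inp qry w u (.work (.inr k)) = u k := rfl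

@[simp] theorem update_tapes_input (x : List (ProgSym ΓA ΓT)) :
    Function.update (tapes inp qry w u) .input x = tapes x qry w u := by
  funext k; rcases k with _ | _ | a | k <;> simp [Function.update, tapes]

@[simp] theorem update_tapes_query (x : List (Option ΓT)) :
    Function.update (tapes inp qry w u) .query x = tapes inp x w u := by
  funext k; rcases k with _ | _ | a | k <;> simp [Function.update, tapes]

@[simp] theorem update_tapes_work (a : WorkStack) (x : List (WorkSym ΓA ΓT)) :
    Function.update (tapes inp qry w u) (.work (.inl a)) x =
      tapes inp qry (Function.update w a x) u := by
  funext k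
  rcases k with _ | _ | b | k
  · simp [Function.update, tapes]
  · simp [Function.update, tapes]
  · by_cases h : b = a
    · subst h; simp
    · rw [Function.update_of_ne (by simpa using h)]; simp [tapes, h]
  · simp [Function.update, tapes]

@[simp] theorem update_tapes_sub (k : K') (x : List (Γ' k)) :
    Function.update (tapes inp qry w u) (.work (.inr k)) x =
      tapes inp qry w (Function.update u k x) := by
  funext k'
  rcases k' with _ | _ | b | k'
  · simp [Function.update, tapes]
  · simp [Function.update, tapes]
  · simp [Function.update, tapes]
  · by_cases h : k' = k
    · subst h; simp
    · rw [Function.update_of_ne (by simpa using h)]; simp [tapes, h]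

end StackLemmas

/-- The contents of the work stacks. -/
def work {α : Type} (prog progRead clock name nameRead scratch derived derivedRead : α) :
    WorkStack → α
  | .prog => prog
  | .progRead => progRead
  | .clock => clock
  | .name => name
  | .nameRead => nameRead
  | .scratch => scratch
  | .derived => derived
  | .derivedRead => derivedRead

section WorkLemmas

variable {α : Type} (a b c d e f g h x : α)

@[simp] theorem work_prog : work a b c d e f g h .prog = a := rfl
@[simp] theorem work_progRead : work a b c d e f g h .progRead = b := rfl
@[simp] theorem work_clock : work a b c d e f g h .clock = c := rfl
@[simp] theorem work_name : work a b c d e f g h .name = d := rfl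
@[simp] theorem work_nameRead : work a b c d e f g h .nameRead = e := rfl
@[simp] theorem work_scratch : work a b c d e f g h .scratch = f := rfl
@[simp] theorem work_derived : work a b c d e f g h .derived = g := rfl
@[simp] theorem work_derivedRead : work a b c d e f g h .derivedRead = h := rfl

@[simp] theorem update_work_prog :
    Function.update (work a b c d e f g h) .prog x = work x b c d e f g h := by
  funext k; cases k <;> rfl
@[simp] theorem update_work_progRead :
    Function.update (work a b c d e f g h) .progRead x = work a x c d e f g h := by
  funext k; cases k <;> rfl
@[simp] theorem update_work_clock :
    Function.update (work a b c d e f g h) .clock x = work a b x d e f g h := by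
  funext k; cases k <;> rfl
@[simp] theorem update_work_name :
    Function.update (work a b c d e f g h) .name x = work a b c x e f g h := by
  funext k; cases k <;> rfl
@[simp] theorem update_work_nameRead :
    Function.update (work a b c d e f g h) .nameRead x = work a b c d x f g h := by
  funext k; cases k <;> rfl
@[simp] theorem update_work_scratch :
    Function.update (work a b c d e f g h) .scratch x = work a b c d e x g h := by
  funext k; cases k <;> rfl
@[simp] theorem update_work_derived :
    Function.update (work a b c d e f g h) .derived x = work a b c d e f x h := by
  funext k; cases k <;> rfl
@[simp] theorem update_work_derivedRead :
    Function.update (work a b c d e f g h) .derivedRead x = work a b c d e f g x := by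
  funext k; cases k <;> rfl

end WorkLemmas

variable {ask : (∀ k, List (verifierAlphabet ΓA ΓT Γ' k)) → Prop}
  {inp : List (ProgSym ΓA ΓT)} {qry : List (Option ΓT)} {u : ∀ k, List (Γ' k)}

/-! ## Moving, clearing and comparing stacks -/

/-- Pops the stack `a` until it is empty; `f` processes the symbols. -/
noncomputable def popLoop (k : Stk (WorkStack ⊕ K'))
    (f : verifierAlphabet ΓA ΓT Γ' k → Option (WorkSym ΓA ΓT))
    (q : Stmt (verifierAlphabet ΓA ΓT Γ') Bool (Registers ΓA ΓT τ) →
      Stmt (verifierAlphabet ΓA ΓT Γ') Bool (Registers ΓA ΓT τ)) :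
    Frag (verifierAlphabet ΓA ΓT Γ') (Registers ΓA ΓT τ) :=
  .loop (.pop k (fun r s => { r with fst := s.bind f })
    (q (.branch (fun r => r.fst.isSome) (.goto fun _ => false) .halt))) .skip

/-- Moves the contents of the stack `a` to the stack `b`, in reversed order. -/
noncomputable def drain (a b : WorkStack) :
    Frag (verifierAlphabet ΓA ΓT Γ') (Registers ΓA ΓT τ) :=
  popLoop (.work (.inl a)) some (.pushOption (.work (.inl b)) fun r => r.fst)

/-- The additional step is the pop from the empty stack, which also leaves `fst` undefined. -/
theorem runs_drain {a b : WorkStack} (hab : a ≠ b) (r : Registers ΓA ΓT τ)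
    (w : WorkStack → List (WorkSym ΓA ΓT)) :
    (drain a b).Runs ask (r, tapes inp qry w u) ((w a).length + 1)
      ({ r with fst := none },
        tapes inp qry (Function.update (Function.update w b ((w a).reverse ++ w b)) a []) u) := by
  generalize hl : w a = l
  induction l generalizing w r with
  | nil =>
    refine Frag.runs_loop_exit ?_
    simp only [stepAux, stepAux_pushOption, tapes_work, update_tapes_work, hl]
    simp [hab.symm, Function.update_comm hab]
  | cons x l ih =>
    refine Frag.runs_loop_continue (v' := { r with fst := some x })
      (S' := tapes inp qry (Function.update (Function.update w a l) b (x :: w b)) u) ?_ ?_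
    · simp [stepAux, hl, hab.symm]
    · refine (ih { r with fst := some x } (Function.update (Function.update w a l) b (x :: w b))
        (by simp [hab])).cast rfl ?_ le_rfl
      simp [Function.update_comm hab]

/-- Empties the stack `a`. -/
noncomputable def clear (a : WorkStack) :
    Frag (verifierAlphabet ΓA ΓT Γ') (Registers ΓA ΓT τ) :=
  popLoop (.work (.inl a)) some id

theorem runs_clear (a : WorkStack) (r : Registers ΓA ΓT τ)
    (w : WorkStack → List (WorkSym ΓA ΓT)) :
    (clear a).Runs ask (r, tapes inp qry w u) ((w a).length + 1)
      ({ r with fst := none }, tapes inp qry (Function.update w a []) u) := by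
  generalize hl : w a = l
  induction l generalizing w r with
  | nil => exact Frag.runs_loop_exit (by simp [stepAux, hl])
  | cons x l ih =>
    refine Frag.runs_loop_continue (v' := { r with fst := some x })
      (S' := tapes inp qry (Function.update w a l) u) ?_ ?_
    · simp [stepAux, hl]
    · exact (ih { r with fst := some x } (Function.update w a l) (by simp)).cast rfl (by simp) le_rfl

open Classical in
/-- Compares `scratch`, which is consumed, with `name`, which is moved to `nameRead`. -/
noncomputable def compareLoop : Frag (verifierAlphabet ΓA ΓT Γ') (Registers ΓA ΓT τ) :=
  .loop (.pop (.work (.inl .scratch)) (fun r s => { r with fst := s })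
    (.pop (.work (.inl .name)) (fun r s => { r with snd := s })
      (.load (fun r => { r with diff := r.diff || decide (r.fst ≠ r.snd) })
        (.pushOption (.work (.inl .nameRead)) (fun r => r.snd)
          (.branch (fun r => r.fst.isSome || r.snd.isSome) (.goto fun _ => false) .halt))))) .skip

-- Both stacks are popped in parallel until both are empty, so a difference in length shows up as a
-- comparison of `none` with a symbol.
open Classical in
theorem runs_compareLoop (r : Registers ΓA ΓT τ) {p pr cl d dr x y z : List (WorkSym ΓA ΓT)} :
    compareLoop.Runs ask (r, tapes inp qry (work p pr cl y z x d dr) u) (x.length + y.length + 1)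
      ({ r with fst := none, snd := none, diff := r.diff || decide (x ≠ y) },
        tapes inp qry (work p pr cl [] (y.reverse ++ z) [] d dr) u) := by
  induction x generalizing y z r with
  | nil =>
    induction y generalizing z r with
    | nil => exact Frag.runs_loop_exit (by simp [stepAux])
    | cons b y ih =>
      refine (Frag.runs_loop_continue (v' := { r with fst := none, snd := some b, diff := true })
        (S' := tapes inp qry (work p pr cl y (b :: z) [] d dr) u) ?_ ?_).mono
          (t := y.length + 1 + 1) (by simp)
      · simp [stepAux]
      · exact (ih { r with fst := none, snd := some b, diff := true }).cast rfl (by simp) (by simp)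
  | cons a x ih =>
    cases y with
    | nil =>
      refine (Frag.runs_loop_continue (v' := { r with fst := some a, snd := none, diff := true })
        (S' := tapes inp qry (work p pr cl [] z x d dr) u) ?_ ?_).mono
          (t := x.length + 1 + 1) (by simp)
      · simp [stepAux]
      · exact (ih { r with fst := some a, snd := none, diff := true }).cast rfl (by simp) (by simp)
    | cons b y =>
      refine (Frag.runs_loop_continue
        (v' := { r with fst := some a, snd := some b, diff := r.diff || decide (a ≠ b) })
        (S' := tapes inp qry (work p pr cl y (b :: z) x d dr) u) ?_ ?_).mono
          (t := x.length + y.length + 1 + 1) (by simp; omega)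
      · simp [stepAux]
      · refine (ih { r with fst := some a, snd := some b, diff := r.diff || decide (a ≠ b) }).cast
          rfl ?_ le_rfl
        by_cases hab : a = b <;> by_cases hxy : x = y <;> simp [hab, hxy]

end Verifier

/-! ### Searching the list of derived atoms -/

section Membership

variable {ΓA ΓT K' τ : Type} [DecidableEq K'] {Γ' : K' → Type}
  {ask : (∀ k, List (verifierAlphabet ΓA ΓT Γ' k)) → Prop}
  {inp : List (ProgSym ΓA ΓT)} {qry : List (Option ΓT)} {u : ∀ k, List (Γ' k)}

/-- The marks in front of the names of atoms, and the mark that stands for `⊥`. -/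
def ProgSym.isAtomMark : ProgSym ΓA ΓT → Bool
  | .regMark | .thyMark | .botMark => true
  | _ => false

/-- The symbols of rule heads. -/
def ProgSym.isAtomSym : ProgSym ΓA ΓT → Bool
  | .posMark | .negMark | .ruleMark => false
  | _ => true

/-- The marks of body literals. -/
def ProgSym.isLitMark : ProgSym ΓA ΓT → Bool
  | .posMark | .negMark => true
  | _ => false

/-- A mark followed by a name. -/
def IsAtomWord (x : List (WorkSym ΓA ΓT)) : Prop :=
  ∃ a l, x = a :: l ∧ a.1.isAtomMark = true ∧ ∀ s ∈ l, s.1.isAtomMark = false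

/-- Compares an atom, which is on `scratch`, with the atom on `name`. -/
noncomputable def scanBody : Frag (verifierAlphabet ΓA ΓT Γ') (Registers ΓA ΓT τ) :=
  .seq compareLoop (.seq (drain .nameRead .name)
    (.basic (.load (fun r => { r with found := r.found || !r.diff, diff := false }) .halt)))

/-- The loop over the symbols of `derived`. -/
noncomputable def scanLoop : Frag (verifierAlphabet ΓA ΓT Γ') (Registers ΓA ΓT τ) :=
  .loop (.pop (.work (.inl .derived)) (fun r s => { r with fst := s })
    (.pushOption (.work (.inl .derivedRead)) (fun r => r.fst)
      (.pushOption (.work (.inl .scratch)) (fun r => r.fst)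
        (.branch (fun r => r.fst.isSome)
          (.load (fun r => { r with diff := false })
            (.goto fun r => r.fst.any fun s => s.1.isAtomMark))
          .halt))))
    scanBody

/-- Before the mark, symbols are merely collected. The continuation is required for all registers
that agree with `r` up to `fst`, because `fst` holds the last symbol read, if any. -/
theorem runs_scanLoop_name (r : Registers ΓA ΓT τ) (hr : r.diff = false)
    {p pr cl y z d dr l : List (WorkSym ΓA ΓT)} (hl : ∀ s ∈ l, s.1.isAtomMark = false)
    {t : ℕ} {s' : Registers ΓA ΓT τ × ∀ k, List (verifierAlphabet ΓA ΓT Γ' k)}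
    (h : ∀ r' : Registers ΓA ΓT τ, { r' with fst := none } = { r with fst := none } →
      scanLoop.Runs ask
        (r', tapes inp qry (work p pr cl y [] (l.reverse ++ z) d (l.reverse ++ dr)) u) t s') :
    scanLoop.Runs ask (r, tapes inp qry (work p pr cl y [] z (l ++ d) dr) u)
      (t + l.length) s' := by
  induction l generalizing r z dr with
  | nil => simpa using h r rfl
  | cons a l ih =>
    refine (Frag.runs_loop_continue (v' := { r with fst := some a })
      (S' := tapes inp qry (work p pr cl y [] (a :: z) (l ++ d) (a :: dr)) u) ?_
        (ih { r with fst := some a } hr (fun s hs => hl s (by simp [hs])) ?_)).cast rfl rfl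
          (by simp)
    · simp [stepAux, hl a (by simp), ← hr]
    · intro r' hr'
      simpa using h r' hr'

-- Words lie reversed on `derived`, so the mark of a word is popped last, and `scratch` then holds
-- the whole word in reading order. Marks do not occur inside names, hence there is one comparison
-- per word. Only comparisons clear `snd`, which explains the case of an empty list.
open Classical in
theorem runs_scanLoop (r : Registers ΓA ΓT τ) (hr : r.diff = false)
    {p pr cl y dr : List (WorkSym ΓA ΓT)} {L : List (List (WorkSym ΓA ΓT))}
    (hL : ∀ x ∈ L, IsAtomWord x) :
    scanLoop.Runs ask
      (r, tapes inp qry (work p pr cl y [] [] (L.flatMap List.reverse) dr) u)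
      ((L.flatMap List.reverse).length * (2 * y.length + 8) + 1)
      ({ r with
          fst := none
          snd := if L = [] then r.snd else none
          found := r.found || decide (y ∈ L) },
        tapes inp qry
          (work p pr cl y [] [] [] ((L.flatMap List.reverse).reverse ++ dr)) u) := by
  induction L generalizing r dr with
  | nil =>
    refine Frag.Runs.cast (Frag.runs_loop_exit (v' := { r with fst := none })
      (S' := tapes inp qry (work p pr cl y [] [] [] dr) u) ?_) rfl ?_ (Nat.le_add_left _ _)
    · simp [stepAux]
    · simp
  | cons x L ih =>
    obtain ⟨a, l, rfl, ha, hl⟩ := hL x (by simp)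
    have ih' := fun (r : Registers ΓA ΓT τ) hr dr =>
      ih r hr (dr := dr) (fun x hx => hL x (by simp [hx]))
    have key : ∀ r' : Registers ΓA ΓT τ, { r' with fst := none } = { r with fst := none } →
      scanLoop.Runs ask
        (r', tapes inp qry (work p pr cl y [] l ([a] ++ L.flatMap List.reverse) (l ++ dr)) u)
        (((l.length + 1) + y.length + 1 + (y.length + 1 + 1)) +
          ((L.flatMap List.reverse).length * (2 * y.length + 8) + 1) + 1)
        ({ r with
            fst := none
            snd := none
            found := r.found || decide (y ∈ (a :: l) :: L) },
          tapes inp qry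
            (work p pr cl y [] [] [] ((L.flatMap List.reverse).reverse ++ (a :: l) ++ dr)) u) := by
      intro r' hr'
      have hd : r'.diff = false := by
        have := congrArg Registers.diff hr'
        simpa [hr] using this
      have hbody : scanBody.Runs ask ({ r' with fst := some a },
          tapes inp qry (work p pr cl y [] (a :: l) (L.flatMap List.reverse) (a :: l ++ dr)) u)
          ((l.length + 1) + y.length + 1 + (y.length + 1 + 1))
          ({ r with fst := none, snd := none, found := r.found || decide (a :: l = y) },
          tapes inp qry (work p pr cl y [] [] (L.flatMap List.reverse) (a :: l ++ dr)) u) := by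
        refine ((runs_compareLoop _).seq ((runs_drain (by decide) _ _).seq
          (Frag.runs_basic (by simp only [stepAux]; rfl)))).cast rfl (Prod.ext ?_ ?_) ?_
        · have := congrArg Registers.found hr'
          obtain ⟨⟩ := r
          obtain ⟨⟩ := r'
          simp_all
        · simp
        · simp
      refine (Frag.runs_loop_body (v' := { r' with fst := some a })
        (S' := tapes inp qry (work p pr cl y [] (a :: l) (L.flatMap List.reverse) (a :: l ++ dr)) u)
        ?_ hbody (ih' _ (by simpa using hr) _)).cast rfl (Prod.ext ?_ ?_) le_rfl
      · simp [stepAux, ha, ← hd]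
      · by_cases h1 : a :: l = y
        · simp [h1]
        · simp [h1, Ne.symm h1]
      · simp
    refine (runs_scanLoop_name r hr (l := l.reverse) (by simpa using hl) (p := p) (pr := pr)
      (cl := cl) (y := y) (z := []) (dr := dr) (inp := inp) (qry := qry) (u := u)
      (d := [a] ++ L.flatMap List.reverse)
      (fun r' hr' => (key r' hr').cast (by simp) rfl le_rfl)).cast ?_ ?_ ?_
    · simp
    · simp
    · simp only [List.flatMap_cons, List.length_append, List.length_reverse, List.length_cons]
      -- The comparison is paid once per word; charging `2 * y.length + 8` to every symbol covers it
      -- because a word has at least its mark.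
      generalize (L.flatMap List.reverse).length = k
      nlinarith [Nat.zero_le (l.length * y.length)]

/-- Tests whether the atom on `name` occurs on `derived`. -/
noncomputable def member : Frag (verifierAlphabet ΓA ΓT Γ') (Registers ΓA ΓT τ) :=
  .seq scanLoop (.seq (drain .derivedRead .derived)
    (.basic (.load (fun r => { r with snd := none }) .halt)))

open Classical in
theorem runs_member (r : Registers ΓA ΓT τ) (hr : r.diff = false)
    {p pr cl y : List (WorkSym ΓA ΓT)} {L : List (List (WorkSym ΓA ΓT))}
    (hL : ∀ x ∈ L, IsAtomWord x) :
    member.Runs ask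
      (r, tapes inp qry (work p pr cl y [] [] (L.flatMap List.reverse) []) u)
      ((L.flatMap List.reverse).length * (2 * y.length + 9) + 3)
      ({ r with fst := none, snd := none, found := r.found || decide (y ∈ L) },
        tapes inp qry (work p pr cl y [] [] (L.flatMap List.reverse) []) u) := by
  refine ((runs_scanLoop r hr hL).seq ((runs_drain (by decide) _ _).seq
    (Frag.runs_basic (by simp only [stepAux]; rfl)))).cast rfl (Prod.ext ?_ ?_) ?_
  · simp
  · simp
  · simp only [work_derivedRead, List.append_nil, List.length_reverse]
    nlinarith

end Membership

/-! ## Subroutines -/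

section Subroutine

variable {ΓA ΓT K' τ : Type} [DecidableEq K'] {Γ' : K' → Type}
  {ask : (∀ k, List (verifierAlphabet ΓA ΓT Γ' k)) → Prop}
  {inp : List (ProgSym ΓA ΓT)} {qry : List (Option ΓT)}
  {w : WorkStack → List (WorkSym ΓA ΓT)}

/-- A statement of a subroutine as a statement of the verifier. -/
def Turing.TM2.Stmt.lift {Λ : Type} :
    Stmt Γ' Λ τ → Stmt (verifierAlphabet ΓA ΓT Γ') Λ (Registers ΓA ΓT τ)
  | .push k f q => .push (.work (.inr k)) (fun r => f r.sub) q.lift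
  | .peek k f q => .peek (.work (.inr k)) (fun r s => { r with sub := f r.sub s }) q.lift
  | .pop k f q => .pop (.work (.inr k)) (fun r s => { r with sub := f r.sub s }) q.lift
  | .load f q => .load (fun r => { r with sub := f r.sub }) q.lift
  | .branch f q₁ q₂ => .branch (fun r => f r.sub) q₁.lift q₂.lift
  | .goto f => .goto fun r => f r.sub
  | .halt => .halt

theorem Turing.TM2.stepAux_lift {Λ : Type} (q : Stmt Γ' Λ τ) (r : Registers ΓA ΓT τ)
    (u : ∀ k, List (Γ' k)) :
    stepAux q.lift r (tapes inp qry w u) =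
      ⟨(stepAux q r.sub u).l, { r with sub := (stepAux q r.sub u).var },
        tapes inp qry w (stepAux q r.sub u).stk⟩ := by
  induction q generalizing r u with
  | branch f q₁ q₂ h₁ h₂ => cases h : f r.sub <;> simp [Stmt.lift, stepAux, h, h₁, h₂]
  | _ => simp_all [Stmt.lift, stepAux]

/-- A program as a fragment. -/
def subroutine {Λ : Type} [Fintype Λ] (m : Λ → Stmt Γ' Λ τ) (main : Λ) :
    Frag (verifierAlphabet ΓA ΓT Γ') (Registers ΓA ΓT τ) where
  Lab := Λ
  entry := main
  code l := (m l).lift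
  query _ := none

theorem iterate_flip_bind_none {C : Type} (f : C → Option C) (n : ℕ) :
    (flip bind f)^[n] none = none := by
  induction n with
  | zero => rfl
  | succ n ih => rw [Function.iterate_succ_apply]; exact ih

/-- The subroutine touches only its own stacks and the register `sub`, so its run is mirrored step
by step. -/
theorem runs_subroutine {Λ : Type} [Fintype Λ] {m : Λ → Stmt Γ' Λ τ} {main : Λ} {t : ℕ}
    {u u' : ∀ k, List (Γ' k)} {v' : τ} (r : Registers ΓA ΓT τ)
    (h : (flip bind (step m))^[t] (some ⟨some main, r.sub, u⟩) = some ⟨none, v', u'⟩) :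
    (subroutine m main).Runs ask (r, tapes inp qry w u) t
      ({ r with sub := v' }, tapes inp qry w u') := by
  intro Λ' R acc e x hl n b hd
  suffices ∀ l r u, (flip bind (step m))^[t] (some ⟨some l, r.sub, u⟩) = some ⟨none, v', u'⟩ →
      Decides R acc ⟨some x, { r with sub := v' }, tapes inp qry w u'⟩ n b →
      Decides R acc ⟨some (e l), r, tapes inp qry w u⟩ (n + t) b from this main r u h hd
  clear h hd
  induction t with
  | zero =>
    intro l r u h
    simp at h
  | succ t ih =>
    intro l r u h hd
    refine hl.step (n := n + t) ?_
    have hn : (subroutine m main).next ask l r (tapes inp qry w u) =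
        ⟨(stepAux (m l) r.sub u).l, { r with sub := (stepAux (m l) r.sub u).var },
          tapes inp qry w (stepAux (m l) r.sub u).stk⟩ := by
      simp [Frag.next, subroutine, stepAux_lift]
    rw [hn]
    rw [Function.iterate_succ_apply] at h
    change (flip bind (step m))^[t] (some (stepAux (m l) r.sub u)) = _ at h
    rcases hc : stepAux (m l) r.sub u with ⟨l', v₁, u₁⟩
    rw [hc] at h
    cases l' with
    | some l' => exact ih l' { r with sub := v₁ } u₁ h hd
    | none =>
      -- The machine has halted, so no steps can be left: another one would make the iterate `none`.
      have : v₁ = v' ∧ u₁ = u' := by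
        cases t with
        | zero => simpa using h
        | succ t =>
          rw [Function.iterate_succ_apply] at h
          cases (iterate_flip_bind_none _ t).symm.trans h
      obtain ⟨rfl, rfl⟩ := this
      exact hd.mono (by omega)

end Subroutine

/-! ## Querying the complement of an atom -/

section Complement

variable {ΓA ΓT : Type} (c : Turing.TM2ComputableAux ΓT ΓT)
  {ask : (∀ k, List (verifierAlphabet ΓA ΓT c.tm.Γ k)) → Prop}
  {inp : List (ProgSym ΓA ΓT)} {qry : List (Option ΓT)}

instance Turing.FinTM2.instFintypeLabel (tm : Turing.FinTM2) : Fintype tm.Λ := tm.ΛFin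

instance Turing.FinTM2.instFintypeState (tm : Turing.FinTM2) : Fintype tm.σ := tm.σFin

/-- The name of a theory atom as a string of work symbols. -/
def nameSyms (ΓA : Type) {ΓT : Type} (l : List ΓT) : List (WorkSym ΓA ΓT) :=
  l.map fun x => (.thySym x, false)

/-- The symbol of the name of a theory atom. -/
def WorkSym.thy? : WorkSym ΓA ΓT → Option ΓT
  | (.thySym x, _) => some x
  | _ => none

/-- Moves a name from `scratch` to the input stack of the subroutine. -/
noncomputable def feedInput :
    Frag (verifierAlphabet ΓA ΓT c.tm.Γ) (Registers ΓA ΓT c.tm.σ) :=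
  popLoop (.work (.inl .scratch)) some
    (.pushOption (.work (.inr c.tm.k₀))
      fun r => (r.fst.bind WorkSym.thy?).map c.inputAlphabet.symm)

theorem runs_feedInput (r : Registers ΓA ΓT c.tm.σ) (l : List ΓT) (u : ∀ k, List (c.tm.Γ k))
    {a b d e f g h : List (WorkSym ΓA ΓT)} :
    (feedInput c).Runs ask
      (r, tapes inp qry (work a b d e f (nameSyms ΓA l) g h) u) (l.length + 1)
      ({ r with fst := none }, tapes inp qry (work a b d e f [] g h)
        (Function.update u c.tm.k₀ (l.reverse.map c.inputAlphabet.symm ++ u c.tm.k₀))) := by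
  induction l generalizing r u with
  | nil => exact Frag.runs_loop_exit (by simp [stepAux, nameSyms])
  | cons x l ih =>
    refine Frag.runs_loop_continue (v' := { r with fst := some (.thySym x, false) })
      (S' := tapes inp qry (work a b d e f (nameSyms ΓA l) g h)
        (Function.update u c.tm.k₀ (c.inputAlphabet.symm x :: u c.tm.k₀))) ?_
      ((ih { r with fst := some (.thySym x, false) } _).cast rfl ?_ le_rfl)
    · simp [stepAux, nameSyms, WorkSym.thy?]
    · simp

/-- Moves a name from the output stack of the subroutine to `scratch`. -/
noncomputable def fetchOutput :
    Frag (verifierAlphabet ΓA ΓT c.tm.Γ) (Registers ΓA ΓT c.tm.σ) :=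
  popLoop (.work (.inr c.tm.k₁)) (fun x => some (.thySym (c.outputAlphabet x), false))
    (.pushOption (.work (.inl .scratch)) fun r => r.fst)

theorem runs_fetchOutput (r : Registers ΓA ΓT c.tm.σ) (l : List ΓT) (u : ∀ k, List (c.tm.Γ k))
    (hu : u c.tm.k₁ = l.map c.outputAlphabet.symm) {a b d e f s g h : List (WorkSym ΓA ΓT)} :
    (fetchOutput c).Runs ask
      (r, tapes inp qry (work a b d e f s g h) u) (l.length + 1)
      ({ r with fst := none }, tapes inp qry (work a b d e f (nameSyms ΓA l.reverse ++ s) g h)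
        (Function.update u c.tm.k₁ [])) := by
  induction l generalizing r u s with
  | nil => exact Frag.runs_loop_exit (by simp [stepAux, nameSyms, hu])
  | cons x l ih =>
    refine Frag.runs_loop_continue (v' := { r with fst := some (.thySym x, false) })
      (S' := tapes inp qry (work a b d e f ((.thySym x, false) :: s) g h)
        (Function.update u c.tm.k₁ (l.map c.outputAlphabet.symm))) ?_
      ((ih { r with fst := some (.thySym x, false) } _ (by simp)).cast rfl ?_ le_rfl)
    · simp [stepAux, hu]
    · simp [nameSyms]

/-- Moves a name from `scratch` to the query stack. -/
noncomputable def pushQuery :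
    Frag (verifierAlphabet ΓA ΓT c.tm.Γ) (Registers ΓA ΓT c.tm.σ) :=
  popLoop (.work (.inl .scratch)) some
    (.pushOption .query fun r => (r.fst.bind WorkSym.thy?).map some)

theorem runs_pushQuery (r : Registers ΓA ΓT c.tm.σ) (l : List ΓT) (u : ∀ k, List (c.tm.Γ k))
    {a b d e f g h : List (WorkSym ΓA ΓT)} :
    (pushQuery c).Runs ask
      (r, tapes inp qry (work a b d e f (nameSyms ΓA l) g h) u) (l.length + 1)
      ({ r with fst := none },
        tapes inp (l.reverse.map some ++ qry) (work a b d e f [] g h) u) := by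
  induction l generalizing r qry with
  | nil => exact Frag.runs_loop_exit (by simp [stepAux, nameSyms])
  | cons x l ih =>
    refine Frag.runs_loop_continue (v' := { r with fst := some (.thySym x, false) })
      (S' := tapes inp (some x :: qry) (work a b d e f (nameSyms ΓA l) g h) u) ?_
      ((ih { r with fst := some (.thySym x, false) }).cast rfl ?_ le_rfl)
    · simp [stepAux, nameSyms, WorkSym.thy?]
    · simp

/-- Computes the complement of the theory atom on `name`, and adds it to the query. -/
noncomputable def queryComplement :
    Frag (verifierAlphabet ΓA ΓT c.tm.Γ) (Registers ΓA ΓT c.tm.σ) :=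
  .seq (drain .name .scratch) <| .seq (feedInput c) <| .seq (subroutine c.tm.m c.tm.main) <|
    .seq (fetchOutput c) <| .seq (pushQuery c) (.basic (.push .query (fun _ => none) .halt))

theorem initList_eq (tm : Turing.FinTM2) (l : List (tm.Γ tm.k₀)) :
    Turing.initList tm l = ⟨some tm.main, tm.initialState,
      Function.update (fun _ => []) tm.k₀ l⟩ := by
  unfold Turing.initList
  congr 1
  funext k
  by_cases h : k = tm.k₀
  · subst h; simp
  · simp [h]

theorem haltList_eq (tm : Turing.FinTM2) (l : List (tm.Γ tm.k₁)) :
    Turing.haltList tm l = ⟨none, tm.initialState, Function.update (fun _ => []) tm.k₁ l⟩ := by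
  unfold Turing.haltList
  congr 1
  funext k
  by_cases h : k = tm.k₁
  · subst h; simp
  · simp [h]

/-- The name is reversed twice on the way into the subroutine, and its complement twice on the way
out, so both are in reading order where it matters. A `FinTM2` ends in its initial internal state
with all stacks but the output empty; once the output is fetched, it is ready for the next call. -/
theorem runs_queryComplement {x y : List ΓT} {t : ℕ}
    (hc : Nonempty (Turing.TM2OutputsInTime c.tm (x.map c.inputAlphabet.invFun)
      (some (y.map c.outputAlphabet.invFun)) t))
    (r : Registers ΓA ΓT c.tm.σ) (hr : r.sub = c.tm.initialState)
    {a b d g h : List (WorkSym ΓA ΓT)} :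
    (queryComplement c).Runs ask
      (r, tapes inp qry (work a b d (nameSyms ΓA x) [] [] g h) fun _ => [])
      (2 * x.length + 2 * y.length + t + 5)
      ({ r with fst := none },
        tapes inp (none :: y.map some ++ qry) (work a b d [] [] [] g h) fun _ => []) := by
  obtain ⟨⟨⟨n, hn⟩, hnt⟩⟩ := hc
  have hn : (flip bind (step c.tm.m))^[n] (some ⟨some c.tm.main, c.tm.initialState,
      Function.update (fun _ => []) c.tm.k₀ (x.map c.inputAlphabet.symm)⟩) =
      some ⟨none, c.tm.initialState,
        Function.update (fun _ => []) c.tm.k₁ (y.map c.outputAlphabet.symm)⟩ := by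
    have := hn
    rw [initList_eq, Option.map_some, haltList_eq] at this
    exact this
  have h1 : (drain .name .scratch).Runs ask
      (r, tapes inp qry (work a b d (nameSyms ΓA x) [] [] g h) fun _ => []) (x.length + 1)
      ({ r with fst := none },
        tapes inp qry (work a b d [] [] (nameSyms ΓA x.reverse) g h) fun _ => []) :=
    (runs_drain (by decide) _ _).cast rfl (by simp [nameSyms]) (by simp [nameSyms])
  have h2 : (feedInput c).Runs ask
      ({ r with fst := none },
        tapes inp qry (work a b d [] [] (nameSyms ΓA x.reverse) g h) fun _ => []) (x.length + 1)
      ({ r with fst := none }, tapes inp qry (work a b d [] [] [] g h)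
        (Function.update (fun _ => []) c.tm.k₀ (x.map c.inputAlphabet.symm))) :=
    (runs_feedInput c _ x.reverse _).cast rfl (by simp) (by simp)
  have h3 : (subroutine c.tm.m c.tm.main).Runs ask
      ({ r with fst := none }, tapes inp qry (work a b d [] [] [] g h)
        (Function.update (fun _ => []) c.tm.k₀ (x.map c.inputAlphabet.symm))) n
      ({ r with fst := none }, tapes inp qry (work a b d [] [] [] g h)
        (Function.update (fun _ => []) c.tm.k₁ (y.map c.outputAlphabet.symm))) :=
    (runs_subroutine (v' := c.tm.initialState) { r with fst := none }
      (by rw [hr]; exact hn)).cast rfl (by simp [hr]) le_rfl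
  have h4 : (fetchOutput c).Runs ask
      ({ r with fst := none }, tapes inp qry (work a b d [] [] [] g h)
        (Function.update (fun _ => []) c.tm.k₁ (y.map c.outputAlphabet.symm))) (y.length + 1)
      ({ r with fst := none },
        tapes inp qry (work a b d [] [] (nameSyms ΓA y.reverse) g h) fun _ => []) :=
    (runs_fetchOutput c _ y _ (by simp)).cast rfl (by simp) le_rfl
  refine (h1.seq (h2.seq
    (h3.seq (h4.seq ((runs_pushQuery c _ y.reverse _).seq
      (Frag.runs_basic (by simp only [stepAux]; rfl))))))).cast rfl ?_ ?_
  · simp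
  · have : n ≤ t := hnt
    simp
    omega

/-- The number of push instructions in a statement. -/
def Turing.TM2.Stmt.pushes {κ : Type} {Γ : κ → Type} {Λ σ : Type} : Stmt Γ Λ σ → ℕ
  | .push _ _ q => q.pushes + 1
  | .peek _ _ q => q.pushes
  | .pop _ _ q => q.pushes
  | .load _ q => q.pushes
  | .branch _ q₁ q₂ => q₁.pushes + q₂.pushes
  | .goto _ => 0
  | .halt => 0

theorem Turing.TM2.length_stepAux_le {κ : Type} [DecidableEq κ] {Γ : κ → Type} {Λ σ : Type}
    (q : Stmt Γ Λ σ) (v : σ) (S : ∀ k, List (Γ k)) (k : κ) :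
    ((stepAux q v S).stk k).length ≤ (S k).length + q.pushes := by
  induction q generalizing v S with
  | push k' f q ih =>
    refine (ih v _).trans ?_
    by_cases h : k = k'
    · subst h; simp [Stmt.pushes]; omega
    · simp [Stmt.pushes, h]
  | pop k' f q ih =>
    refine (ih _ _).trans ?_
    by_cases h : k = k'
    · subst h; simp [Stmt.pushes]
    · simp [Stmt.pushes, h]
  | peek k' f q ih => exact ih _ _
  | load f q ih => exact ih _ _
  | branch f q₁ q₂ ih₁ ih₂ =>
    have h1 := ih₁ v S
    have h2 := ih₂ v S
    cases h : f v <;> simp [stepAux, Stmt.pushes, h] <;> omega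
  | goto f => simp [stepAux, Stmt.pushes]
  | halt => simp [stepAux, Stmt.pushes]

/-- A bound for the number of symbols that one step of a machine pushes. -/
def Turing.FinTM2.pushBound (tm : Turing.FinTM2) : ℕ := ∑ l : tm.Λ, (tm.m l).pushes

theorem length_iterate_step_le (tm : Turing.FinTM2) (n : ℕ) (c d : tm.Cfg)
    (h : (flip bind tm.step)^[n] (some c) = some d) (k : tm.K) :
    (Cfg.stk d k).length ≤ (Cfg.stk c k).length + n * tm.pushBound := by
  induction n generalizing c with
  | zero =>
    have : c = d := by simpa using h
    simp [this]
  | succ n ih =>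
    rw [Function.iterate_succ_apply] at h
    obtain ⟨l, v, S⟩ := c
    cases l with
    | none =>
      cases (iterate_flip_bind_none _ n).symm.trans h
    | some l =>
      have h1 := ih (stepAux (tm.m l) v S) h
      have h2 := length_stepAux_le (tm.m l) v S k
      have h3 : (tm.m l).pushes ≤ tm.pushBound :=
        Finset.single_le_sum (f := fun l => (tm.m l).pushes) (fun _ _ => Nat.zero_le _)
          (Finset.mem_univ l)
      have h4 : (Cfg.stk (⟨some l, v, S⟩ : Cfg tm.Γ tm.Λ tm.σ) k).length = (S k).length := rfl
      rw [h4, add_mul, one_mul]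
      omega

/-- Each step pushes at most `pushBound` symbols. This bounds the cost of copying the computed
complement. -/
theorem length_output_le {x y : List ΓT} {t : ℕ}
    (hc : Nonempty (Turing.TM2OutputsInTime c.tm (x.map c.inputAlphabet.invFun)
      (some (y.map c.outputAlphabet.invFun)) t)) :
    y.length ≤ x.length + t * c.tm.pushBound := by
  obtain ⟨⟨⟨n, hn⟩, hnt⟩⟩ := hc
  have h := length_iterate_step_le c.tm n _ _ hn c.tm.k₁
  rw [initList_eq, haltList_eq] at h
  simp only [Function.update_self, List.length_map] at h
  have hk : ∀ k, (Function.update (fun k => ([] : List (c.tm.Γ k))) c.tm.k₀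
      (x.map c.inputAlphabet.invFun) k).length ≤ x.length := by
    intro k
    by_cases hk : k = c.tm.k₀
    · subst hk; simp
    · simp [hk]
  exact h.trans (Nat.add_le_add (hk _) (Nat.mul_le_mul_right _ hnt))

end Complement

/-! ## Programs with guessed truth values -/

section GuessedPrograms

/-- A rule with guessed truth values for its body literals. -/
structure GuessRule (A T : Type) where
  head : Option (A ⊕ T)
  pos : List ((A ⊕ T) × Bool)
  neg : List ((A ⊕ T) × Bool)

/-- The rule without the guess. -/
def GuessRule.erase {A T : Type} (r : GuessRule A T) : TRule A T :=
  ⟨r.head, r.pos.map Prod.fst, r.neg.map Prod.fst⟩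

/-- The data of the verifier: derived heads (where `none` is `⊥`), theory atoms for the final
query, and two flags. -/
structure DerivState (A T : Type) where
  derived : List (Option (A ⊕ T))
  queried : List T
  applicable : Bool
  reject : Bool

/-- Processes a program from the last symbol to the first: `lit` and `rule` are applied at the
literals and at the rules. -/
def foldProgram {A T S : Type} (lit : Bool → Bool → A ⊕ T → S → S)
    (rule : Option (A ⊕ T) → S → S) (P : List (GuessRule A T)) (s : S) : S :=
  P.foldr (fun r s => rule r.head (r.pos.foldr (fun l s => lit true l.2 l.1 s)
    (r.neg.foldr (fun l s => lit false l.2 l.1 s) s))) s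

variable {A T ΓA ΓT : Type} (encA : Computability.Encoding A ΓA)
  (encT : Computability.Encoding T ΓT)

/-- The code of an atom as a string of work symbols. -/
def atomWord (a : A ⊕ T) : List (WorkSym ΓA ΓT) := (atomCode encA encT a).map fun x => (x, false)

/-- The code of a rule head as a string of work symbols. -/
def headWord : Option (A ⊕ T) → List (WorkSym ΓA ΓT)
  | none => [(.botMark, false)]
  | some a => atomWord encA encT a

/-- The mark of positive and of negative body literals. -/
def litMark (pos : Bool) : ProgSym ΓA ΓT := if pos then .posMark else .negMark

/-- The string of a body literal. -/
def litWord (pos : Bool) (l : (A ⊕ T) × Bool) : List (WorkSym ΓA ΓT) :=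
  (litMark pos, l.2) :: atomWord encA encT l.1

/-- The string of a rule with guessed truth values. -/
def guessRuleWord (r : GuessRule A T) : List (WorkSym ΓA ΓT) :=
  (.ruleMark, false) :: (headWord encA encT r.head ++
    (r.pos.flatMap (litWord encA encT true) ++ r.neg.flatMap (litWord encA encT false)))

/-- The string of a program with guessed truth values. -/
def guessWord (P : List (GuessRule A T)) : List (WorkSym ΓA ΓT) :=
  P.flatMap (guessRuleWord encA encT)

/-- The string of a list of derived heads, as it is found on a stack. -/
def derivedWord (L : List (Option (A ⊕ T))) : List (WorkSym ΓA ΓT) :=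
  (L.map (headWord encA encT)).flatMap List.reverse

@[simp] theorem derivedWord_cons (a : Option (A ⊕ T)) (L : List (Option (A ⊕ T))) :
    derivedWord encA encT (a :: L) = (headWord encA encT a).reverse ++ derivedWord encA encT L := by
  simp [derivedWord]

theorem isAtomWord_headWord (h : Option (A ⊕ T)) : IsAtomWord (headWord encA encT h) := by
  rcases h with _ | a | t
  · exact ⟨_, [], rfl, rfl, by simp⟩
  · exact ⟨_, _, rfl, rfl, by simp [ProgSym.isAtomMark]⟩
  · exact ⟨_, _, rfl, rfl, by simp [ProgSym.isAtomMark]⟩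

theorem isAtomSym_headWord (h : Option (A ⊕ T)) :
    ∀ s ∈ headWord encA encT h, s.1.isAtomSym = true := by
  rcases h with _ | a | t <;> simp [headWord, atomWord, atomCode, ProgSym.isAtomSym]

/-- The first mark tells the kind of head and the encodings are injective, so comparing strings
decides equality of heads. -/
theorem headWord_injective : Function.Injective (headWord encA encT) := by
  have hA : Function.Injective (ProgSym.regSym : ΓA → ProgSym ΓA ΓT) := fun a b h => by
    simpa using h
  have hT : Function.Injective (ProgSym.thySym : ΓT → ProgSym ΓA ΓT) := fun a b h => by
    simpa using h
  have hp : Function.Injective (fun x : ProgSym ΓA ΓT => (x, false)) := fun a b h => by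
    simpa using h
  intro x y h
  rcases x with _ | a | t <;> rcases y with _ | a' | t' <;>
    simp only [headWord, atomWord, atomCode, List.map_cons, List.cons.injEq, Prod.mk.injEq,
      reduceCtorEq, false_and, and_true, true_and, hp.list_map.eq_iff, hA.list_map.eq_iff,
      hT.list_map.eq_iff] at h
  · rfl
  · rw [encA.encode_injective h]
  · rw [encT.encode_injective h]

end GuessedPrograms

/-! ## Passes over a program -/

section Passes

variable {A T ΓA ΓT : Type} (encA : Computability.Encoding A ΓA)
  (encT : Computability.Encoding T ΓT) (c : Turing.TM2ComputableAux ΓT ΓT)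
  {ask : (∀ k, List (verifierAlphabet ΓA ΓT c.tm.Γ k)) → Prop}

/-- The registers between two symbols. -/
def restRegisters (s : DerivState A T) : Registers ΓA ΓT c.tm.σ where
  cur := none
  fst := none
  snd := none
  diff := false
  found := false
  applicable := s.applicable
  reject := s.reject
  answer := false
  sub := c.tm.initialState

/-- The stacks while a program is processed. -/
def passTapes (prog progRead clock name : List (WorkSym ΓA ΓT)) (s : DerivState A T) :
    ∀ k, List (verifierAlphabet ΓA ΓT c.tm.Γ k) :=
  tapes [] (atomListCode encT s.queried)
    (work prog progRead clock name [] [] (derivedWord encA encT s.derived) []) fun _ => []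

/-- The state between two literals. -/
def passState (prog progRead clock : List (WorkSym ΓA ΓT)) (s : DerivState A T) :
    Registers ΓA ΓT c.tm.σ × ∀ k, List (verifierAlphabet ΓA ΓT c.tm.Γ k) :=
  (restRegisters c s, passTapes encA encT c prog progRead clock [] s)

/-- The fragment `H` performs the updates `lit` at literals and `rule` at rules, in time `B`. -/
structure Handles (ask : (∀ k, List (verifierAlphabet ΓA ΓT c.tm.Γ k)) → Prop)
    (H : Frag (verifierAlphabet ΓA ΓT c.tm.Γ) (Registers ΓA ΓT c.tm.σ))
    (lit : Bool → Bool → A ⊕ T → DerivState A T → DerivState A T)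
    (rule : Option (A ⊕ T) → DerivState A T → DerivState A T) (B : ℕ → ℕ) : Prop where
  runs_lit : ∀ pos bit a s prog progRead clock N,
    (derivedWord encA encT s.derived).length + (atomWord encA encT a).length ≤ N →
    H.Runs ask ({ restRegisters c s with cur := some (litMark pos, bit) },
      passTapes encA encT c prog progRead clock (atomWord encA encT a) s) (B N)
      (passState encA encT c prog progRead clock (lit pos bit a s))
  runs_rule : ∀ h s prog progRead clock N,
    (derivedWord encA encT s.derived).length + (headWord encA encT h).length ≤ N →
    H.Runs ask ({ restRegisters c s with cur := some (.ruleMark, false) },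
      passTapes encA encT c prog progRead clock (headWord encA encT h) s) (B N)
      (passState encA encT c prog progRead clock (rule h s))
  length_lit : ∀ pos bit a s, (derivedWord encA encT (lit pos bit a s).derived).length ≤
    (derivedWord encA encT s.derived).length + (atomWord encA encT a).length
  length_rule : ∀ h s, (derivedWord encA encT (rule h s).derived).length ≤
    (derivedWord encA encT s.derived).length + (headWord encA encT h).length

/-- Moves through the program and calls `H` at the marks of literals and rules. -/
noncomputable def passLoop
    (H : Frag (verifierAlphabet ΓA ΓT c.tm.Γ) (Registers ΓA ΓT c.tm.σ)) :
    Frag (verifierAlphabet ΓA ΓT c.tm.Γ) (Registers ΓA ΓT c.tm.σ) :=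
  .loop (.pop (.work (.inl .prog)) (fun r s => { r with cur := s })
    (.pushOption (.work (.inl .progRead)) (fun r => r.cur)
      (.branch (fun r => r.cur.isSome)
        (.pushOption (.work (.inl .name)) (fun r => r.cur.filter fun s => s.1.isAtomSym)
          (.goto fun r => !(r.cur.any fun s => s.1.isAtomSym)))
        .halt))) H

/-- One pass over the program. -/
noncomputable def pass
    (H : Frag (verifierAlphabet ΓA ΓT c.tm.Γ) (Registers ΓA ΓT c.tm.σ)) :
    Frag (verifierAlphabet ΓA ΓT c.tm.Γ) (Registers ΓA ΓT c.tm.σ) :=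
  .seq (passLoop c H) (drain .progRead .prog)

variable {H : Frag (verifierAlphabet ΓA ΓT c.tm.Γ) (Registers ΓA ΓT c.tm.σ)}

/-- The program is read from its last symbol, so an atom is met before the mark of its literal or
rule, and pushing its symbols on `name` restores their order. -/
theorem runs_passLoop_name (r : Registers ΓA ΓT c.tm.σ) (s : DerivState A T)
    {p q cl y l : List (WorkSym ΓA ΓT)} (hl : ∀ s ∈ l, s.1.isAtomSym = true)
    {t : ℕ} {s' : Registers ΓA ΓT c.tm.σ × ∀ k, List (verifierAlphabet ΓA ΓT c.tm.Γ k)}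
    (h : ∀ r' : Registers ΓA ΓT c.tm.σ, { r' with cur := none } = { r with cur := none } →
      (passLoop c H).Runs ask
        (r', passTapes encA encT c p (l.reverse ++ q) cl (l.reverse ++ y) s) t s') :
    (passLoop c H).Runs ask (r, passTapes encA encT c (l ++ p) q cl y s) (t + l.length) s' := by
  induction l generalizing r q y with
  | nil => simpa using h r rfl
  | cons a l ih =>
    refine (Frag.runs_loop_continue (v' := { r with cur := some a })
      (S' := passTapes encA encT c (l ++ p) (a :: q) cl (a :: y) s) ?_
        (ih { r with cur := some a } (fun s hs => hl s (by simp [hs])) ?_)).cast rfl rfl (by simp)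
    · simp [stepAux, passTapes, hl a (by simp), Option.filter]
    · intro r' hr'
      simpa using h r' hr'

/-- The loop processes the string `w` at the top of the program, taking `s₁` to `s₂`. -/
def Passes (ask : (∀ k, List (verifierAlphabet ΓA ΓT c.tm.Γ k)) → Prop)
    (H : Frag (verifierAlphabet ΓA ΓT c.tm.Γ) (Registers ΓA ΓT c.tm.σ)) (B : ℕ → ℕ)
    (w : List (WorkSym ΓA ΓT)) (s₁ s₂ : DerivState A T) : Prop :=
  (derivedWord encA encT s₂.derived).length ≤
      (derivedWord encA encT s₁.derived).length + w.length ∧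
    ∀ N, (derivedWord encA encT s₁.derived).length + w.length ≤ N → ∀ p q cl t s',
      (passLoop c H).Runs ask (passState encA encT c p (w ++ q) cl s₂) t s' →
      (passLoop c H).Runs ask (passState encA encT c (w.reverse ++ p) q cl s₁)
        (t + w.length * (B N + 1)) s'

variable {encA encT c} {B : ℕ → ℕ}

theorem Passes.nil (s : DerivState A T) : Passes encA encT c ask H B [] s s :=
  ⟨by simp, fun N _ p q cl t s' h => by simpa using h⟩

/-- As the program is stored in reverse, `w'` is treated first. The growth bound in `Passes` ensures
that the same `N` still suffices for `w`. -/
theorem Passes.append {w w' : List (WorkSym ΓA ΓT)} {s₁ s₂ s₃ : DerivState A T}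
    (h' : Passes encA encT c ask H B w' s₁ s₂) (h : Passes encA encT c ask H B w s₂ s₃) :
    Passes encA encT c ask H B (w ++ w') s₁ s₃ := by
  refine ⟨?_, fun N hN p q cl t s' hr => ?_⟩
  · have := h.1; have := h'.1
    simp only [List.length_append]; omega
  · have h1 := h'.1
    simp only [List.length_append] at hN
    have := h'.2 N (by omega) (w.reverse ++ p) q cl _ _
      (h.2 N (by omega) p (w' ++ q) cl t s' (by simpa using hr))
    refine this.cast (by simp) rfl (by simp only [List.length_append]; nlinarith)

theorem Passes.word {a : WorkSym ΓA ΓT} (ha : a.1.isAtomSym = false) {w : List (WorkSym ΓA ΓT)}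
    (hw : ∀ x ∈ w, x.1.isAtomSym = true) {s₁ s₂ : DerivState A T}
    (hl : (derivedWord encA encT s₂.derived).length ≤
      (derivedWord encA encT s₁.derived).length + w.length)
    (hB : ∀ prog progRead clock N, (derivedWord encA encT s₁.derived).length + w.length ≤ N →
      H.Runs ask ({ restRegisters c s₁ with cur := some a },
        passTapes encA encT c prog progRead clock w s₁) (B N)
        (passState encA encT c prog progRead clock s₂)) :
    Passes encA encT c ask H B (a :: w) s₁ s₂ := by
  refine ⟨by simp only [List.length_cons]; omega, fun N hN p q cl t s' hr => ?_⟩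
  refine (runs_passLoop_name encA encT c (restRegisters c s₁) s₁ (p := a :: p) (q := q) (cl := cl)
    (y := []) (l := w.reverse) (t := B N + t + 1) (s' := s') (by simpa using hw) ?_).cast ?_ rfl ?_
  · intro r' hr'
    refine Frag.runs_loop_body (v' := { restRegisters c s₁ with cur := some a })
      (S' := passTapes encA encT c p (a :: w ++ q) cl w s₁) ?_ ?_ hr
    · have : ({ r' with cur := some a } : Registers ΓA ΓT c.tm.σ) =
          { restRegisters c s₁ with cur := some a } := by
        have := congrArg (fun r : Registers ΓA ΓT c.tm.σ => { r with cur := some a }) hr'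
        exact this
      simp [stepAux, passTapes, ha, Option.filter, ← this]
    · exact hB _ _ _ N (by simp only [List.length_cons] at hN; omega)
  · simp [passState]
  · simp only [List.length_reverse, List.length_cons]
    nlinarith

variable {lit : Bool → Bool → A ⊕ T → DerivState A T → DerivState A T}
  {rule : Option (A ⊕ T) → DerivState A T → DerivState A T}

theorem Handles.passes_lits (hH : Handles encA encT c ask H lit rule B) (pos : Bool)
    (L : List ((A ⊕ T) × Bool)) (s : DerivState A T) :
    Passes encA encT c ask H B (L.flatMap (litWord encA encT pos)) s
      (L.foldr (fun l s => lit pos l.2 l.1 s) s) := by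
  induction L with
  | nil => exact .nil s
  | cons l L ih =>
    refine ih.append (Passes.word ?_ (isAtomSym_headWord encA encT (some l.1)) ?_ ?_)
    · cases pos <;> rfl
    · exact hH.length_lit _ _ _ _
    · exact hH.runs_lit _ _ _ _

theorem Handles.passes_program (hH : Handles encA encT c ask H lit rule B)
    (P : List (GuessRule A T)) (s : DerivState A T) :
    Passes encA encT c ask H B (guessWord encA encT P) s (foldProgram lit rule P s) := by
  induction P with
  | nil => exact .nil s
  | cons r P ih =>
    refine ih.append ?_
    -- Reading backwards meets the negative body, then the positive body, then the head: the order
    -- in `foldProgram`.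
    have := (((hH.passes_lits false r.neg (foldProgram lit rule P s)).append
      (hH.passes_lits true r.pos _)).append (Passes.word (a := (.ruleMark, false)) rfl
        (isAtomSym_headWord encA encT r.head) (hH.length_rule r.head _) (hH.runs_rule r.head _)))
    exact this

theorem Handles.runs_pass (hH : Handles encA encT c ask H lit rule B)
    (P : List (GuessRule A T)) (s : DerivState A T) {N : ℕ}
    (hN : (derivedWord encA encT s.derived).length + (guessWord encA encT P).length ≤ N)
    (cl : List (WorkSym ΓA ΓT)) :
    (pass c H).Runs ask (passState encA encT c (guessWord encA encT P).reverse [] cl s)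
      ((guessWord encA encT P).length * (B N + 2) + 2)
      (passState encA encT c (guessWord encA encT P).reverse [] cl (foldProgram lit rule P s)) := by
  have h1 := (hH.passes_program P s).2 N hN [] [] cl 1
    (passState encA encT c [] (guessWord encA encT P) cl (foldProgram lit rule P s))
    (Frag.runs_loop_exit (by simp [stepAux, passTapes, restRegisters]))
  refine ((h1.cast (by simp) rfl le_rfl).seq (runs_drain (by decide) _ _)).cast rfl ?_ ?_
  · simp [passState, restRegisters, passTapes]
  · simp only [work_progRead]
    nlinarith

end Passes

/-! ## The three kinds of passes -/

section Handlers

variable {A T ΓA ΓT : Type} (encA : Computability.Encoding A ΓA)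
  (encT : Computability.Encoding T ΓT) (c : Turing.TM2ComputableAux ΓT ΓT)
  {ask : (∀ k, List (verifierAlphabet ΓA ΓT c.tm.Γ k)) → Prop}

def ProgSym.isRuleMark : ProgSym ΓA ΓT → Bool
  | .ruleMark => true
  | _ => false

def ProgSym.isPosMark : ProgSym ΓA ΓT → Bool
  | .posMark => true
  | _ => false

def ProgSym.isThyMark : ProgSym ΓA ΓT → Bool
  | .thyMark => true
  | _ => false

def ProgSym.isBotMark : ProgSym ΓA ΓT → Bool
  | .botMark => true
  | _ => false

/-- Clears the temporary registers. -/
def Registers.reset {τ : Type} (r : Registers ΓA ΓT τ) : Registers ΓA ΓT τ :=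
  { r with cur := none, fst := none, snd := none, diff := false, found := false }

/-- Takes the guessed truth values of theory atoms into account: the true ones count as derived,
and the complements of the false ones are added to the query. -/
noncomputable def initHandler : Frag (verifierAlphabet ΓA ΓT c.tm.Γ) (Registers ΓA ΓT c.tm.σ) :=
  .seq
    (.ite (fun r => r.cur.any fun s => s.1.isRuleMark) (clear .name)
      (.seq (.basic (.peek (.work (.inl .name)) (fun r s => { r with fst := s }) .halt))
        (.ite (fun r => r.fst.any fun s => s.1.isThyMark)
          (.ite (fun r => r.cur.any Prod.snd) (drain .name .derived)
            (.seq (.basic (.pop (.work (.inl .name)) (fun r _ => r) .halt)) (queryComplement c)))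
          (clear .name))))
    (.basic (.load Registers.reset .halt))

/-- Tests whether the atom on `name` is derived; then moves it to `derived` or clears it. -/
noncomputable def memberHandler (g : Registers ΓA ΓT c.tm.σ → Bool)
    (f : Registers ΓA ΓT c.tm.σ → Registers ΓA ΓT c.tm.σ) :
    Frag (verifierAlphabet ΓA ΓT c.tm.Γ) (Registers ΓA ΓT c.tm.σ) :=
  .seq member (.seq (.ite g (drain .name .derived) (clear .name)) (.basic (.load f .halt)))

/-- Derives the heads of applicable rules. -/
noncomputable def deriveHandler : Frag (verifierAlphabet ΓA ΓT c.tm.Γ) (Registers ΓA ΓT c.tm.σ) :=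
  memberHandler c (fun r => (r.cur.any fun s => s.1.isRuleMark) && r.applicable)
    (fun r => { r.reset with
      applicable := (r.cur.any fun s => s.1.isRuleMark) ||
        (r.applicable && if r.cur.any fun s => s.1.isPosMark then r.found else !r.cur.any Prod.snd) })

/-- Compares the guessed truth values with the derived atoms. -/
noncomputable def checkHandler : Frag (verifierAlphabet ΓA ΓT c.tm.Γ) (Registers ΓA ΓT c.tm.σ) :=
  memberHandler c (fun _ => false)
    (fun r => { r.reset with
      reject := r.reject ||
        (!(r.cur.any fun s => s.1.isRuleMark) && (r.found != r.cur.any Prod.snd)) })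

/-- The update of the initial pass at a literal, for the complement `comp`. -/
def initLit (comp : T → T) (_ bit : Bool) (a : A ⊕ T) (s : DerivState A T) : DerivState A T :=
  match a with
  | .inl _ => s
  | .inr t =>
    if bit then { s with derived := some (.inr t) :: s.derived }
    else { s with queried := comp t :: s.queried }

open Classical in
/-- The update of a derivation pass at a literal. -/
noncomputable def deriveLit (pos bit : Bool) (a : A ⊕ T) (s : DerivState A T) : DerivState A T :=
  { s with applicable := s.applicable && if pos then decide (some a ∈ s.derived) else !bit }

/-- The update of a derivation pass at a rule. -/
def deriveRule (h : Option (A ⊕ T)) (s : DerivState A T) : DerivState A T :=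
  { s with
    derived := if s.applicable then h :: s.derived else s.derived
    applicable := true }

open Classical in
/-- The update of the final pass at a literal. -/
noncomputable def checkLit (_ bit : Bool) (a : A ⊕ T) (s : DerivState A T) : DerivState A T :=
  { s with reject := s.reject || (decide (some a ∈ s.derived) != bit) }

theorem atomWord_inr (t : T) : atomWord encA encT (.inr t) =
    (.thyMark, false) :: nameSyms ΓA (encT.encode t) := by
  simp [atomWord, atomCode, nameSyms]

theorem Polynomial.eval_le_eval_nat (p : Polynomial ℕ) {m n : ℕ} (h : m ≤ n) :
    p.eval m ≤ p.eval n := by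
  simp only [Polynomial.eval_eq_sum, Polynomial.sum]
  exact Finset.sum_le_sum fun i _ => Nat.mul_le_mul_left _ (Nat.pow_le_pow_left h i)

/-- The costly case is a theory atom guessed false. Its complement has length at most `N + time.eval
N * c.tm.pushBound` and is moved twice, which explains the factors `4` and `2 * c.tm.pushBound + 1`.
-/
theorem handles_initHandler {comp : T → T} {time : Polynomial ℕ}
    (hc : ∀ t, Nonempty (Turing.TM2OutputsInTime c.tm
      ((encT.encode t).map c.inputAlphabet.invFun)
      (some ((encT.encode (comp t)).map c.outputAlphabet.invFun))
      (time.eval (encT.encode t).length))) :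
    Handles encA encT c ask (initHandler c) (initLit comp) (fun _ s => s)
      (fun N => 4 * N + time.eval N * (2 * c.tm.pushBound + 1) + 12) := by
  refine ⟨?_, ?_, ?_, ?_⟩
  · intro pos bit a s prog progRead cl N hN
    have hm : (litMark pos : ProgSym ΓA ΓT).isRuleMark = false := by cases pos <;> rfl
    rcases a with a | t
    · refine ((Frag.Runs.ite_false (by simp [hm])
        ((Frag.runs_basic (by simp only [stepAux]; rfl)).seq
          (Frag.Runs.ite_false ?_ (runs_clear _ _ _)))).seq
          (Frag.runs_basic (by simp only [stepAux]; rfl))).cast rfl ?_ ?_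
      · simp [passTapes, atomWord, atomCode, ProgSym.isThyMark]
      · simp [passState, passTapes, restRegisters, Registers.reset, initLit]
      · simp only [work_name]
        omega
    · cases bit
      · have h1 : (queryComplement c).Runs ask
          ({ restRegisters c s with
              cur := some (litMark pos, false), fst := some (.thyMark, false) },
            passTapes encA encT c prog progRead cl (nameSyms ΓA (encT.encode t)) s) _ _ :=
          runs_queryComplement c (hc t) _ rfl
        refine ((Frag.Runs.ite_false (by simp [hm])
          ((Frag.runs_basic (v' := { restRegisters c s with
              cur := some (litMark pos, false), fst := some (.thyMark, false) })
            (S' := passTapes encA encT c prog progRead cl (atomWord encA encT (.inr t)) s)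
            (by simp [stepAux, passTapes, atomWord_inr])).seq
            (Frag.Runs.ite_true rfl
              (Frag.Runs.ite_false rfl
                ((Frag.runs_basic (v' := { restRegisters c s with
                    cur := some (litMark pos, false), fst := some (.thyMark, false) })
                  (S' := passTapes encA encT c prog progRead cl (nameSyms ΓA (encT.encode t)) s)
                  (by simp [stepAux, passTapes, atomWord_inr])).seq h1))))).seq
            (Frag.runs_basic (by simp only [stepAux]; rfl))).cast rfl ?_ ?_
        · simp [passState, passTapes, restRegisters, Registers.reset, initLit, atomListCode]
        · have hl : (encT.encode t).length + 1 ≤ N := by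
            have : (atomWord encA encT (.inr t)).length = (encT.encode t).length + 1 := by
              simp [atomWord_inr, nameSyms]
            omega
          have h2 := length_output_le c (hc t)
          have h3 := Polynomial.eval_le_eval_nat time (show (encT.encode t).length ≤ N by omega)
          have h4 := Nat.mul_le_mul_right c.tm.pushBound h3
          nlinarith
      · refine ((Frag.Runs.ite_false (by simp [hm])
          ((Frag.runs_basic (v' := { restRegisters c s with
              cur := some (litMark pos, true), fst := some (.thyMark, false) })
            (S' := passTapes encA encT c prog progRead cl (atomWord encA encT (.inr t)) s)
            (by simp [stepAux, passTapes, atomWord_inr])).seq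
            (Frag.Runs.ite_true rfl
              (Frag.Runs.ite_true rfl (runs_drain (by decide) _ _))))).seq
            (Frag.runs_basic (by simp only [stepAux]; rfl))).cast rfl ?_ ?_
        · simp [passState, passTapes, restRegisters, Registers.reset, initLit, headWord]
        · simp only [work_name]
          omega
  · intro h s prog progRead cl N hN
    refine ((Frag.Runs.ite_true rfl (runs_clear _ _ _)).seq
      (Frag.runs_basic (by simp only [stepAux]; rfl))).cast rfl ?_ ?_
    · simp [passState, passTapes, restRegisters, Registers.reset]
    · simp only [work_name]
      omega
  · intro pos bit a s
    rcases a with a | t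
    · simp [initLit]
    · cases bit <;> simp [initLit, headWord, add_comm]
  · intro h s
    simp

-- Deriving and checking share the membership test and differ in whether the atom is kept (`g`) and
-- in the new registers (`f`), so both reduce to equations between records.
open Classical in
theorem runs_memberHandler {g : Registers ΓA ΓT c.tm.σ → Bool}
    {f : Registers ΓA ΓT c.tm.σ → Registers ΓA ΓT c.tm.σ} (h : Option (A ⊕ T))
    (s s' : DerivState A T) (x : WorkSym ΓA ΓT) {prog progRead cl : List (WorkSym ΓA ΓT)} {N : ℕ}
    (hN : (derivedWord encA encT s.derived).length + (headWord encA encT h).length ≤ N)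
    (hq : s'.queried = s.queried)
    (hf : f { restRegisters c s with cur := some x, found := decide (h ∈ s.derived) } =
      restRegisters c s')
    (hg : s'.derived =
      if g { restRegisters c s with cur := some x, found := decide (h ∈ s.derived) }
      then h :: s.derived else s.derived) :
    (memberHandler c g f).Runs ask ({ restRegisters c s with cur := some x },
      passTapes encA encT c prog progRead cl (headWord encA encT h) s) (N * (2 * N + 10) + 8)
      (passState encA encT c prog progRead cl s') := by
  have hmem : headWord encA encT h ∈ s.derived.map (headWord encA encT) ↔ h ∈ s.derived :=
    List.mem_map_of_injective (headWord_injective encA encT)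
  have h1 : member.Runs ask ({ restRegisters c s with cur := some x },
      passTapes encA encT c prog progRead cl (headWord encA encT h) s)
      ((derivedWord encA encT s.derived).length * (2 * (headWord encA encT h).length + 9) + 3)
      ({ restRegisters c s with cur := some x, found := decide (h ∈ s.derived) },
      passTapes encA encT c prog progRead cl (headWord encA encT h) s) := by
    refine (runs_member _ rfl (L := s.derived.map (headWord encA encT)) ?_).cast rfl ?_ le_rfl
    · intro y hy
      obtain ⟨a, -, rfl⟩ := List.mem_map.1 hy
      exact isAtomWord_headWord encA encT a
    · simp [restRegisters, hmem, passTapes, derivedWord]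
  have hB : ((derivedWord encA encT s.derived).length * (2 * (headWord encA encT h).length + 9) + 3)
      + (((headWord encA encT h).length + 1 + 1) + 1) ≤ N * (2 * N + 10) + 8 := by
    have h2 : (derivedWord encA encT s.derived).length ≤ N := by omega
    have h3 : (headWord encA encT h).length ≤ N := by omega
    have := Nat.mul_le_mul h2 (show 2 * (headWord encA encT h).length + 9 ≤ 2 * N + 9 by omega)
    nlinarith
  cases hgv : g { restRegisters c s with cur := some x, found := decide (h ∈ s.derived) }
  · refine (h1.seq ((Frag.Runs.ite_false hgv (runs_clear _ _ _)).seq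
      (Frag.runs_basic (by simp only [stepAux]; rfl)))).cast rfl ?_ hB
    refine Prod.ext ?_ ?_
    · exact hf
    · simp [passState, passTapes, hq, hg, hgv]
  · refine (h1.seq ((Frag.Runs.ite_true hgv (runs_drain (by decide) _ _)).seq
      (Frag.runs_basic (by simp only [stepAux]; rfl)))).cast rfl ?_ hB
    refine Prod.ext ?_ ?_
    · exact hf
    · simp [passState, passTapes, hq, hg, hgv]

theorem handles_deriveHandler :
    Handles encA encT c ask (deriveHandler c) (deriveLit (A := A) (T := T)) deriveRule
      (fun N => N * (2 * N + 10) + 8) := by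
  refine ⟨?_, ?_, ?_, ?_⟩
  · intro pos bit a s prog progRead cl N hN
    refine runs_memberHandler encA encT c (some a) s _ _ hN rfl ?_ ?_ <;>
      cases pos <;>
      simp [litMark, restRegisters, Registers.reset, deriveLit, ProgSym.isRuleMark,
        ProgSym.isPosMark]
  · intro h s prog progRead cl N hN
    refine runs_memberHandler encA encT c h s _ _ hN rfl ?_ ?_ <;>
      simp [restRegisters, Registers.reset, deriveRule, ProgSym.isRuleMark]
  · intro pos bit a s
    simp [deriveLit]
  · intro h s
    cases hs : s.applicable <;> simp [deriveRule, hs, add_comm]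

theorem handles_checkHandler :
    Handles encA encT c ask (checkHandler c) (checkLit (A := A) (T := T)) (fun _ s => s)
      (fun N => N * (2 * N + 10) + 8) := by
  refine ⟨?_, ?_, ?_, ?_⟩
  · intro pos bit a s prog progRead cl N hN
    refine runs_memberHandler encA encT c (some a) s _ _ hN rfl ?_ ?_ <;>
      cases pos <;>
      simp [litMark, restRegisters, Registers.reset, checkLit, ProgSym.isRuleMark]
  · intro h s prog progRead cl N hN
    refine runs_memberHandler encA encT c h s _ _ hN rfl ?_ ?_ <;>
      simp [restRegisters, Registers.reset, ProgSym.isRuleMark]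
  · intro pos bit a s
    simp [checkLit]
  · intro h s
    simp

end Handlers

/-! ## The verifier -/

section Program

variable {A T ΓA ΓT : Type} (encA : Computability.Encoding A ΓA)
  (encT : Computability.Encoding T ΓT) (c : Turing.TM2ComputableAux ΓT ΓT)
  {ask : (∀ k, List (verifierAlphabet ΓA ΓT c.tm.Γ k)) → Prop}

theorem foldProgram_invariant {S : Type} {lit : Bool → Bool → A ⊕ T → S → S}
    {rule : Option (A ⊕ T) → S → S} (p : S → Prop)
    (hlit : ∀ pos bit a s, p s → p (lit pos bit a s)) (hrule : ∀ h s, p s → p (rule h s))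
    (P : List (GuessRule A T)) {s : S} (hs : p s) : p (foldProgram lit rule P s) := by
  have hlits : ∀ pos (L : List ((A ⊕ T) × Bool)) s, p s →
      p (L.foldr (fun l s => lit pos l.2 l.1 s) s) := by
    intro pos L s hs
    induction L with
    | nil => exact hs
    | cons l L ih => exact hlit _ _ _ _ ih
  induction P with
  | nil => exact hs
  | cons r P ih => exact hrule _ _ (hlits _ _ _ (hlits _ _ _ ih))

/-- As many derivation passes as there are symbols on `clock`. -/
noncomputable def rounds : Frag (verifierAlphabet ΓA ΓT c.tm.Γ) (Registers ΓA ΓT c.tm.σ) :=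
  .loop (.pop (.work (.inl .clock)) (fun r s => { r with fst := s })
    (.branch (fun r => r.fst.isSome) (.load (fun r => { r with fst := none }) (.goto fun _ => true))
      .halt)) (pass c (deriveHandler c))

/-- The update of a derivation pass. -/
noncomputable def deriveRound (P : List (GuessRule A T)) : DerivState A T → DerivState A T :=
  foldProgram deriveLit deriveRule P

/-- Heads derived earlier are pushed again, so the list keeps growing, but by at most the length of
the program per round; hence the product in `hN`. -/
theorem runs_rounds (P : List (GuessRule A T)) (cl : List (WorkSym ΓA ΓT)) (s : DerivState A T)
    {N : ℕ} (hN : (derivedWord encA encT s.derived).length +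
      cl.length * (guessWord encA encT P).length ≤ N) :
    (rounds c).Runs ask (passState encA encT c (guessWord encA encT P).reverse [] cl s)
      (cl.length * ((guessWord encA encT P).length * (N * (2 * N + 10) + 10) + 3) + 1)
      (passState encA encT c (guessWord encA encT P).reverse [] []
        ((deriveRound P)^[cl.length] s)) := by
  induction cl generalizing s with
  | nil =>
    exact (Frag.runs_loop_exit (v' := restRegisters c s)
      (S' := passTapes encA encT c (guessWord encA encT P).reverse [] [] [] s)
      (by simp [stepAux, passTapes, restRegisters])).cast rfl rfl (by simp)
  | cons x cl ih =>
    have h1 := ((handles_deriveHandler encA encT c (ask := ask)).passes_program P s).1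
    simp only [List.length_cons] at hN
    have h2 := (handles_deriveHandler encA encT c (ask := ask)).runs_pass P s (N := N)
      (by nlinarith) cl
    refine (Frag.runs_loop_body ?_ h2 (ih (deriveRound P s) ?_)).cast rfl rfl ?_
    · simp [stepAux, passTapes, restRegisters]
    · unfold deriveRound
      nlinarith
    · simp only [List.length_cons]
      nlinarith

/-- The symbol that is added to the query for a symbol of a derived atom. -/
def WorkSym.query? : WorkSym ΓA ΓT → Option (Option ΓT)
  | (.thySym x, _) => some (some x)
  | (.thyMark, _) => some none
  | _ => none

/-- Adds the derived theory atoms to the query, and rejects if `⊥` is derived. -/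
noncomputable def queryDerived : Frag (verifierAlphabet ΓA ΓT c.tm.Γ) (Registers ΓA ΓT c.tm.σ) :=
  .loop (.pop (.work (.inl .derived)) (fun r s => { r with fst := s })
    (.pushOption .query (fun r => r.fst.bind WorkSym.query?)
      (.load (fun r => { r with reject := r.reject || r.fst.any fun s => s.1.isBotMark })
        (.branch (fun r => r.fst.isSome) (.goto fun _ => false) .halt)))) .skip

theorem runs_queryDerived (r : Registers ΓA ΓT c.tm.σ) (d : List (WorkSym ΓA ΓT))
    {qry : List (Option ΓT)} {p q cl : List (WorkSym ΓA ΓT)} :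
    (queryDerived c).Runs ask
      (r, tapes [] qry (work p q cl [] [] [] d []) fun _ => []) (d.length + 1)
      ({ r with fst := none, reject := r.reject || d.any fun s => s.1.isBotMark },
        tapes [] (d.reverse.filterMap WorkSym.query? ++ qry) (work p q cl [] [] [] [] [])
          fun _ => []) := by
  induction d generalizing r qry with
  | nil => exact Frag.runs_loop_exit (by simp [stepAux])
  | cons a d ih =>
    refine Frag.runs_loop_continue
      (v' := { r with fst := some a, reject := r.reject || a.1.isBotMark })
      (S' := tapes [] ((WorkSym.query? a).toList ++ qry) (work p q cl [] [] [] d []) fun _ => []) ?_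
      ((ih _).cast rfl ?_ le_rfl)
    · simp [stepAux]
    · cases h : WorkSym.query? a <;> simp [h, Bool.or_assoc]

/-- The theory atoms in a list of derived heads. -/
def derivedTheoryAtoms (L : List (Option (A ⊕ T))) : List T :=
  L.reverse.filterMap fun h => h.bind Sum.getRight?

/-- Each `thyMark` is popped after its name and puts the separator on top of it, which is the format
of the oracle. Regular atoms and `⊥` leave no trace in the query. -/
theorem filterMap_derivedWord (L : List (Option (A ⊕ T))) :
    (derivedWord encA encT L).reverse.filterMap WorkSym.query? =
      atomListCode encT (derivedTheoryAtoms L) := by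
  have h1 : (derivedWord encA encT L).reverse = L.reverse.flatMap (headWord encA encT) := by
    induction L with
    | nil => rfl
    | cons a L ih => simp [ih]
  rw [h1, derivedTheoryAtoms]
  induction L.reverse with
  | nil => rfl
  | cons a L ih =>
    rw [List.flatMap_cons, List.filterMap_append, ih]
    have hreg : ∀ l : List ΓA, (l.map fun x => ((.regSym x, false) : WorkSym ΓA ΓT)).filterMap
        WorkSym.query? = [] := by
      intro l
      induction l with
      | nil => rfl
      | cons x l ih => exact ih
    have hthy : ∀ l : List ΓT, (l.map fun x => ((.thySym x, false) : WorkSym ΓA ΓT)).filterMap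
        WorkSym.query? = l.map some := by
      intro l
      induction l with
      | nil => rfl
      | cons x l ih => exact congrArg (some x :: ·) ih
    rcases a with _ | a | t
    · rfl
    · have : headWord encA encT (some (.inl a)) =
          (.regMark, false) :: (encA.encode a).map fun x => (.regSym x, false) := by
        simp [headWord, atomWord, atomCode]
      rw [this, List.filterMap_cons_none rfl, hreg]
      rfl
    · have : headWord encA encT (some (.inr t)) =
          (.thyMark, false) :: (encT.encode t).map fun x => (.thySym x, false) := by
        simp [headWord, atomWord, atomCode]
      rw [this, List.filterMap_cons_some
        (show WorkSym.query? ((.thyMark, false) : WorkSym ΓA ΓT) = some none from rfl), hthy]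
      rfl

open Classical in
theorem any_isBotMark_derivedWord (L : List (Option (A ⊕ T))) :
    ((derivedWord encA encT L).any fun s => s.1.isBotMark) = decide (none ∈ L) := by
  induction L with
  | nil => simp [derivedWord]
  | cons a L ih =>
    rw [derivedWord_cons, List.any_append, ih, List.any_reverse]
    rcases a with _ | a | t <;>
      simp [headWord, atomWord, atomCode, ProgSym.isBotMark]

/-- The deterministic part of the verifier. -/
noncomputable def verifier : Frag (verifierAlphabet ΓA ΓT c.tm.Γ) (Registers ΓA ΓT c.tm.σ) :=
  .seq (pass c (initHandler c)) <| .seq (rounds c) <| .seq (pass c (checkHandler c)) <|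
    .seq (queryDerived c) (.askOracle fun b r => { r with answer := b })

/-- The accepting internal states of the verifier. -/
def Registers.accepts {τ : Type} (r : Registers ΓA ΓT τ) : Bool := r.answer && !r.reject

/-- The initial data of the verifier. -/
def DerivState.init : DerivState A T := ⟨[], [], true, false⟩

/-- The data after the initial pass. -/
def guessedState (comp : T → T) (P : List (GuessRule A T)) : DerivState A T :=
  foldProgram (initLit comp) (fun _ s => s) P .init

/-- The data after the derivation passes. -/
noncomputable def derivedState (comp : T → T) (P : List (GuessRule A T)) : DerivState A T :=
  (deriveRound P)^[(guessWord encA encT P).length] (guessedState comp P)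

/-- The data after all passes. -/
noncomputable def checkedState (comp : T → T) (P : List (GuessRule A T)) : DerivState A T :=
  foldProgram checkLit (fun _ s => s) P (derivedState encA encT comp P)

/-- The condition under which the verifier accepts. -/
def VerifierAccepts (comp : T → T) (O : Set (List (Option ΓT))) (P : List (GuessRule A T)) : Prop :=
  (checkedState encA encT comp P).reject = false ∧
    none ∉ (checkedState encA encT comp P).derived ∧
    atomListCode encT (derivedTheoryAtoms (checkedState encA encT comp P).derived ++
      (checkedState encA encT comp P).queried) ∈ O

/-- A bound for the length of the derived atoms, for programs of length `l`. -/
def derivedBound (l : ℕ) : ℕ := (l + 2) * l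

/-- A bound for the running time of the deterministic part, for programs of length `l`. -/
def verifierBound (time : Polynomial ℕ) (C l : ℕ) : ℕ :=
  l * (4 * derivedBound l + time.eval (derivedBound l) * (2 * C + 1) + 14) +
    (l + 1) * (l * (derivedBound l * (2 * derivedBound l + 10) + 10) + 3) + derivedBound l + 10

-- One bound `N` serves all phases: after the initial pass and `k` rounds the derived list has at
-- most `(k + 1) * w.length` symbols, `k` is at most `w.length`, and a further `w.length` leaves
-- room for the current pass.
variable {encA encT c} in
theorem runs_verifier {comp : T → T} {time : Polynomial ℕ}
    (hc : ∀ t, Nonempty (Turing.TM2OutputsInTime c.tm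
      ((encT.encode t).map c.inputAlphabet.invFun)
      (some ((encT.encode (comp t)).map c.outputAlphabet.invFun))
      (time.eval (encT.encode t).length)))
    (O : Set (List (Option ΓT))) (P : List (GuessRule A T)) :
    ∃ s', (verifier c).Runs (Stk.Asks O)
      (passState encA encT c (guessWord encA encT P).reverse [] (guessWord encA encT P).reverse
        .init) (verifierBound time c.tm.pushBound (guessWord encA encT P).length) s' ∧
      (s'.1.accepts = true ↔ VerifierAccepts encA encT comp O P) := by
  classical
  set w := guessWord encA encT P with hw
  set N := derivedBound w.length with hN
  have hle : w.length * (w.length + 2) ≤ N := by rw [hN, derivedBound, mul_comm]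
  have hinit := handles_initHandler encA encT c (ask := Stk.Asks O) hc
  have hlen1 : (derivedWord encA encT (guessedState comp P).derived).length ≤ w.length := by
    have := (hinit.passes_program P .init).1
    simpa [DerivState.init, derivedWord, guessedState] using this
  have hlen2 : ∀ k, (derivedWord encA encT ((deriveRound P)^[k] (guessedState comp P)).derived).length
      ≤ w.length + k * w.length := by
    intro k
    induction k with
    | zero => simpa using hlen1
    | succ k ih =>
      rw [Function.iterate_succ_apply']
      have := ((handles_deriveHandler encA encT c (ask := Stk.Asks O)).passes_program P
        ((deriveRound P)^[k] (guessedState comp P))).1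
      change (derivedWord encA encT (deriveRound P _).derived).length ≤ _ at this
      rw [add_mul, one_mul]
      rw [← hw] at this
      omega
  have hlen2' := hlen2 w.length
  have hcheck := handles_checkHandler encA encT c (ask := Stk.Asks O)
  have h1 := hinit.runs_pass P .init (N := N)
    (by simp only [DerivState.init, derivedWord, List.map_nil, List.flatMap_nil, List.length_nil]
        nlinarith) w.reverse
  have h2 := runs_rounds encA encT c (ask := Stk.Asks O) P w.reverse (guessedState comp P) (N := N)
    (by simp only [List.length_reverse, ← hw]; nlinarith)
  have h3 := hcheck.runs_pass P (derivedState encA encT comp P) (N := N)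
    (by unfold derivedState; rw [← hw]; nlinarith) []
  -- The final pass changes only `reject`, so the list sent to the oracle is the one that was
  -- checked.
  have hder : (checkedState encA encT comp P).derived = (derivedState encA encT comp P).derived :=
    foldProgram_invariant (lit := checkLit) (rule := fun _ s => s) (fun s : DerivState A T => s.derived = (derivedState encA encT comp P).derived)
      (fun _ _ _ _ h => h) (fun _ _ h => h) P rfl
  have h4 := runs_queryDerived c (ask := Stk.Asks O)
    (restRegisters c (checkedState encA encT comp P))
    (derivedWord encA encT (checkedState encA encT comp P).derived)
    (qry := atomListCode encT (checkedState encA encT comp P).queried) (p := w.reverse) (q := [])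
    (cl := [])
  refine ⟨_, (h1.seq ((h2.cast rfl ?_ le_rfl).seq (h3.seq (h4.seq Frag.runs_askOracle)))).mono ?_, ?_⟩
  · simp [derivedState, ← hw]
  · have h5 : (derivedWord encA encT (checkedState encA encT comp P).derived).length ≤ N := by
      rw [hder]
      unfold derivedState
      rw [← hw]
      nlinarith
    rw [verifierBound, ← hN, ← hw, List.length_reverse]
    nlinarith
  · have hask : Stk.Asks O (tapes (K' := c.tm.K) (Γ' := c.tm.Γ) ([] : List (ProgSym ΓA ΓT))
        ((derivedWord encA encT (checkedState encA encT comp P).derived).reverse.filterMap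
          WorkSym.query? ++ atomListCode encT (checkedState encA encT comp P).queried)
        (work w.reverse [] [] [] [] [] [] []) fun _ => []) ↔
        atomListCode encT (derivedTheoryAtoms (checkedState encA encT comp P).derived ++
          (checkedState encA encT comp P).queried) ∈ O := by
      rw [filterMap_derivedWord]
      simp [Stk.Asks, atomListCode]
    simp only [Registers.accepts, VerifierAccepts, any_isBotMark_derivedWord, Bool.and_eq_true,
      decide_eq_true_eq, Bool.not_eq_true', Bool.or_eq_false_iff, decide_eq_false_iff_not, hask,
      restRegisters]
    tauto

end Program

/-! ## The guessing phase -/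

section Guess

variable {A T ΓA ΓT : Type} (encA : Computability.Encoding A ΓA)
  (encT : Computability.Encoding T ΓT)

/-- `w` is the string `l` with truth values, which are `false` at all symbols but the marks of
body literals. -/
def IsGuess (l : List (ProgSym ΓA ΓT)) (w : List (WorkSym ΓA ΓT)) : Prop :=
  List.Forall₂ (fun x y => y.1 = x ∧ (x.isLitMark = false → y.2 = false)) l w

theorem isGuess_cons {x : ProgSym ΓA ΓT} {l : List (ProgSym ΓA ΓT)} {w : List (WorkSym ΓA ΓT)} :
    IsGuess (x :: l) w ↔ ∃ b w', w = (x, b && x.isLitMark) :: w' ∧ IsGuess l w' := by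
  unfold IsGuess
  rw [List.forall₂_cons_left_iff]
  constructor
  · rintro ⟨⟨y, b⟩, w', ⟨rfl, hb⟩, hw, rfl⟩
    refine ⟨b, w', ?_, hw⟩
    cases h : y.isLitMark <;> simp_all
  · rintro ⟨b, w', rfl, hw⟩
    exact ⟨_, w', ⟨rfl, fun h => by simp [h]⟩, hw, rfl⟩

theorem isGuess_append {l l' : List (ProgSym ΓA ΓT)} {w : List (WorkSym ΓA ΓT)} :
    IsGuess (l ++ l') w ↔ ∃ w₁ w₂, w = w₁ ++ w₂ ∧ IsGuess l w₁ ∧ IsGuess l' w₂ := by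
  induction l generalizing w with
  | nil =>
    constructor
    · exact fun h => ⟨[], w, rfl, .nil, h⟩
    · rintro ⟨w₁, w₂, rfl, h1, h2⟩
      cases h1
      exact h2
  | cons x l ih =>
    rw [List.cons_append, isGuess_cons]
    simp only [ih, isGuess_cons]
    constructor
    · rintro ⟨b, _, rfl, w₁, w₂, rfl, h1, h2⟩
      exact ⟨_, w₂, rfl, ⟨b, w₁, rfl, h1⟩, h2⟩
    · rintro ⟨_, w₂, rfl, ⟨b, w₁, rfl, h1⟩, h2⟩
      exact ⟨b, _, rfl, w₁, w₂, rfl, h1, h2⟩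

theorem isGuess_iff_of_forall {l : List (ProgSym ΓA ΓT)} (hl : ∀ x ∈ l, x.isLitMark = false)
    {w : List (WorkSym ΓA ΓT)} : IsGuess l w ↔ w = l.map fun x => (x, false) := by
  induction l generalizing w with
  | nil => simp [IsGuess]
  | cons x l ih =>
    rw [isGuess_cons]
    simp only [ih fun y hy => hl y (by simp [hy]), hl x (by simp), Bool.and_false, List.map_cons]
    simp

theorem isGuess_atomCode (a : A ⊕ T) {w : List (WorkSym ΓA ΓT)} :
    IsGuess (atomCode encA encT a) w ↔ w = atomWord encA encT a :=
  isGuess_iff_of_forall (by rcases a with a | t <;> simp [atomCode, ProgSym.isLitMark])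

theorem isGuess_lits (pos : Bool) (L : List (A ⊕ T)) {w : List (WorkSym ΓA ΓT)} :
    IsGuess (L.flatMap fun b => litMark pos :: atomCode encA encT b) w ↔
      ∃ L' : List ((A ⊕ T) × Bool), L'.map Prod.fst = L ∧
        w = L'.flatMap (litWord encA encT pos) := by
  have hm : (litMark pos : ProgSym ΓA ΓT).isLitMark = true := by cases pos <;> rfl
  induction L generalizing w with
  | nil => simp [IsGuess]
  | cons a L ih =>
    rw [List.flatMap_cons, List.cons_append, isGuess_cons]
    simp only [isGuess_append, isGuess_atomCode, ih, hm, Bool.and_true]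
    constructor
    · rintro ⟨b, _, rfl, _, _, rfl, rfl, L', rfl, rfl⟩
      exact ⟨(a, b) :: L', rfl, rfl⟩
    · rintro ⟨_ | ⟨⟨a', b⟩, L'⟩, h, rfl⟩
      · simp at h
      · obtain ⟨rfl, rfl⟩ : a' = a ∧ L'.map Prod.fst = L := by simpa using h
        exact ⟨b, _, rfl, _, _, rfl, rfl, L', rfl, rfl⟩

theorem isGuess_ruleCode (r : TRule A T) {w : List (WorkSym ΓA ΓT)} :
    IsGuess (ruleCode encA encT r) w ↔
      ∃ r' : GuessRule A T, r'.erase = r ∧ w = guessRuleWord encA encT r' := by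
  obtain ⟨v, hv, hr⟩ : ∃ v, (∀ w, IsGuess v w ↔ w = headWord encA encT r.head) ∧
      ruleCode encA encT r = .ruleMark :: (v ++
        r.pos.flatMap (fun b => .posMark :: atomCode encA encT b) ++
        r.neg.flatMap (fun b => .negMark :: atomCode encA encT b)) := by
    rcases r with ⟨_ | a, L, L'⟩
    · exact ⟨_, fun w => isGuess_iff_of_forall (by simp [ProgSym.isLitMark]), rfl⟩
    · exact ⟨_, fun w => isGuess_atomCode encA encT a, rfl⟩
  have hpos := fun w => isGuess_lits encA encT (w := w) true r.pos
  have hneg := fun w => isGuess_lits encA encT (w := w) false r.neg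
  simp only [litMark, if_true, Bool.false_eq_true, if_false] at hpos hneg
  rw [hr, isGuess_cons]
  simp only [isGuess_append, hv, hpos, hneg, ProgSym.isLitMark, Bool.and_false]
  constructor
  · rintro ⟨_, _, rfl, _, _, rfl, ⟨_, _, rfl, rfl, L, hL, rfl⟩, L', hL', rfl⟩
    exact ⟨⟨r.head, L, L'⟩, by rw [GuessRule.erase, hL, hL'], by simp [guessRuleWord]⟩
  · rintro ⟨⟨h, L, L'⟩, rfl, rfl⟩
    exact ⟨true, _, rfl, _, _, (List.append_assoc _ _ _).symm,
      ⟨_, _, rfl, rfl, L, rfl, rfl⟩, L', rfl, rfl⟩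

/-- Bits are free exactly at the marks of literals, so guessing symbol by symbol, without parsing,
yields precisely the annotated programs. -/
theorem isGuess_programCode (P : List (TRule A T)) {w : List (WorkSym ΓA ΓT)} :
    IsGuess (programCode encA encT P) w ↔
      ∃ P' : List (GuessRule A T), P'.map GuessRule.erase = P ∧ w = guessWord encA encT P' := by
  induction P generalizing w with
  | nil => simp [IsGuess, programCode, guessWord]
  | cons r P ih =>
    change IsGuess (ruleCode encA encT r ++ programCode encA encT P) w ↔ _
    simp only [isGuess_append, ih, isGuess_ruleCode]
    constructor
    · rintro ⟨_, _, rfl, ⟨r', rfl, rfl⟩, P', rfl, rfl⟩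
      exact ⟨r' :: P', rfl, rfl⟩
    · rintro ⟨_ | ⟨r', P'⟩, h, rfl⟩
      · simp at h
      · obtain ⟨rfl, rfl⟩ : r'.erase = r ∧ P'.map GuessRule.erase = P := by simpa using h
        exact ⟨_, _, rfl, ⟨r', rfl, rfl⟩, P', rfl, rfl⟩

theorem IsGuess.length_eq {l : List (ProgSym ΓA ΓT)} {w : List (WorkSym ΓA ΓT)}
    (h : IsGuess l w) : l.length = w.length := List.Forall₂.length_eq h

variable (c : Turing.TM2ComputableAux ΓT ΓT)

/-- Moves a symbol of the input to the program, with a guessed truth value. -/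
noncomputable def guessStmt (b : Bool) :
    Stmt (verifierAlphabet ΓA ΓT c.tm.Γ) Bool (Registers ΓA ΓT c.tm.σ) :=
  .pop .input (fun r s => { r with cur := s.map fun x => (x, b && x.isLitMark) })
    (.pushOption (.work (.inl .prog)) (fun r => r.cur)
      (.pushOption (.work (.inl .clock)) (fun r => r.cur)
        (.goto fun r => r.cur.isSome)))

instance Turing.FinTM2.instFintypeStackIndex (tm : Turing.FinTM2) : Fintype tm.K := tm.kFin

variable [Finite ΓA] [Finite ΓT]

noncomputable instance : Fintype (Registers ΓA ΓT c.tm.σ) := Fintype.ofFinite _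

/-- The nondeterministic machine for the satisfiability problem. -/
noncomputable def verifierMachine : OracleNTM (ProgSym ΓA ΓT) (Option ΓT) :=
  (verifier c).toMachine (guessStmt c) (restRegisters c (DerivState.init (A := Empty) (T := Empty)))
    Registers.accepts

variable {c} {O : Set (List (Option ΓT))}

/-- Induction on the unread input, for any stack `y` of symbols already moved. Shifting `p` by each
guessed symbol merges the successive choices into one existential over words. -/
theorem decides_guess {p : List (WorkSym ΓA ΓT) → Prop} {n : ℕ} (l : List (ProgSym ΓA ΓT))
    (y : List (WorkSym ΓA ΓT)) (r r₀ : Registers ΓA ΓT c.tm.σ)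
    (hr : { r with cur := none } = r₀)
    (h : ∀ w, IsGuess l w → Decides ((verifierMachine (ΓA := ΓA) c).Step O)
      (verifierMachine c).AcceptCfg
      ⟨some (.inl (verifier c).entry), r₀, tapes [] []
        (work (w.reverse ++ y) [] (w.reverse ++ y) [] [] [] [] []) fun _ => []⟩ n (p w)) :
    Decides ((verifierMachine (ΓA := ΓA) c).Step O) (verifierMachine c).AcceptCfg
      ⟨some (.inr true), r, tapes l [] (work y [] y [] [] [] [] []) fun _ => []⟩
      (n + (l.length + 1)) (∃ w, IsGuess l w ∧ p w) := by
  induction l generalizing y r p with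
  | nil =>
    -- Popping the empty input leaves the loop, and the bit has no effect; this is the `+ 1` in the
    -- bound.
    refine (Frag.toMachine_guess_step (n := n) (p := fun _ => p []) fun b => ?_).congr ?_
    · subst hr
      have := h [] .nil
      simp only [stepAux_link, guessStmt, stepAux, stepAux_pushOption]
      simpa using! this
    · simp [IsGuess]
  | cons x l ih =>
    refine ((Frag.toMachine_guess_step (n := n + (l.length + 1))
      (p := fun b => ∃ w, IsGuess l w ∧ p ((x, b && x.isLitMark) :: w)) fun b => ?_).congr ?_).mono
        (by simp only [List.length_cons]; omega)
    · have := ih (p := fun w => p ((x, b && x.isLitMark) :: w)) ((x, b && x.isLitMark) :: y)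
        { r with cur := some (x, b && x.isLitMark) } hr (fun w hw => by
          simpa using h ((x, b && x.isLitMark) :: w) (isGuess_cons.2 ⟨b, w, rfl, hw⟩))
      simp only [stepAux_link, guessStmt, stepAux, stepAux_pushOption]
      simpa using! this
    · simp only [isGuess_cons]
      constructor
      · rintro ⟨b, w, hw, hp⟩
        exact ⟨_, ⟨b, w, rfl, hw⟩, hp⟩
      · rintro ⟨_, ⟨b, w, rfl, hw⟩, hp⟩
        exact ⟨b, w, hw, hp⟩

theorem decides_verifierMachine {comp : T → T} {time : Polynomial ℕ}
    (hc : ∀ t, Nonempty (Turing.TM2OutputsInTime c.tm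
      ((encT.encode t).map c.inputAlphabet.invFun)
      (some ((encT.encode (comp t)).map c.outputAlphabet.invFun))
      (time.eval (encT.encode t).length))) (P : List (TRule A T)) :
    Decides ((verifierMachine (ΓA := ΓA) c).Step O) (verifierMachine c).AcceptCfg
      ((verifierMachine c).initCfg (programCode encA encT P))
      (verifierBound time c.tm.pushBound (programCode encA encT P).length + 1 +
        ((programCode encA encT P).length + 1))
      (∃ P' : List (GuessRule A T), P'.map GuessRule.erase = P ∧
        VerifierAccepts encA encT comp O P') := by
  have hd := fun P' => (runs_verifier (encA := encA) hc O P').elim fun s' hs' =>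
    (hs'.1.decides_toMachine (g := guessStmt c)
      (init := restRegisters c (DerivState.init (A := Empty) (T := Empty)))
      (accept := Registers.accepts)).congr hs'.2
  have key := decides_guess (c := c) (O := O)
    -- Acceptance itself is the predicate on words; it is translated afterwards, once the word is
    -- known to encode an annotated program.
    (p := fun w => ∃ m d, RelPath ((verifierMachine (ΓA := ΓA) c).Step O) m
      ⟨some (.inl (verifier c).entry), restRegisters c (DerivState.init (A := A) (T := T)),
        passTapes encA encT c w.reverse [] w.reverse [] .init⟩ d ∧
      (verifierMachine (ΓA := ΓA) c).AcceptCfg d)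
    (n := verifierBound time c.tm.pushBound (programCode encA encT P).length + 1)
    -- The initial registers use only the two flags of the data, so those for `Empty` and for `A`,
    -- `T` agree by `rfl`.
    (programCode encA encT P) [] (restRegisters c (DerivState.init (A := Empty) (T := Empty)))
    (restRegisters c (DerivState.init (A := A) (T := T))) rfl ?_
  · have hinit : (verifierMachine (ΓA := ΓA) c).initCfg (programCode encA encT P) =
        ⟨some (.inr true), restRegisters c (DerivState.init (A := Empty) (T := Empty)),
          tapes (programCode encA encT P) [] (work [] [] [] [] [] [] [] []) fun _ => []⟩ := by
      refine congrArg (Cfg.mk _ _) (funext fun k => ?_)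
      rcases k with _ | _ | a | k
      · rfl
      · rfl
      · cases a <;> rfl
      · rfl
    rw [hinit]
    refine key.congr ?_
    simp only [isGuess_programCode]
    constructor
    · rintro ⟨_, ⟨P', h, rfl⟩, hp⟩
      exact ⟨P', h, (hd P').accepts.1 hp⟩
    · rintro ⟨P', h, hP'⟩
      exact ⟨_, ⟨P', h, rfl⟩, (hd P').accepts.2 hP'⟩
  · intro w hw
    obtain ⟨P', hP', rfl⟩ := (isGuess_programCode encA encT P).1 hw
    rw [hw.length_eq, List.append_nil]
    exact ⟨(hd P').bounded, Iff.rfl⟩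

end Guess

/-! ## The derived atoms -/

section Derivation

variable {A T ΓA ΓT : Type}

/-- The body literals of a program, with their guessed truth values. -/
def bodyLits (P : List (GuessRule A T)) : List ((A ⊕ T) × Bool) :=
  P.flatMap fun r => r.pos ++ r.neg

/-- The initial and the final pass ignore heads and the signs of literals, so only the list of body
literals matters to them. -/
theorem foldProgram_eq_foldr {S : Type} (lit : Bool → Bool → A ⊕ T → S → S)
    (hlit : lit false = lit true) (P : List (GuessRule A T)) (s : S) :
    foldProgram lit (fun _ s => s) P s =
      (bodyLits P).foldr (fun l s => lit true l.2 l.1 s) s := by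
  induction P with
  | nil => rfl
  | cons r P ih =>
    rw [bodyLits, List.flatMap_cons, List.foldr_append, List.foldr_append, ← bodyLits, ← ih,
      foldProgram, List.foldr_cons, hlit, foldProgram, hlit]

theorem foldr_initLit (comp : T → T) (L : List ((A ⊕ T) × Bool)) (s : DerivState A T) :
    (∀ x, x ∈ (L.foldr (fun l s => initLit comp true l.2 l.1 s) s).derived ↔
      (∃ t, (.inr t, true) ∈ L ∧ x = some (.inr t)) ∨ x ∈ s.derived) ∧
    (∀ x, x ∈ (L.foldr (fun l s => initLit comp true l.2 l.1 s) s).queried ↔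
      (∃ t, (.inr t, false) ∈ L ∧ x = comp t) ∨ x ∈ s.queried) ∧
    (L.foldr (fun l s => initLit comp true l.2 l.1 s) s).applicable = s.applicable ∧
    (L.foldr (fun l s => initLit comp true l.2 l.1 s) s).reject = s.reject := by
  induction L with
  | nil => simp
  | cons l L ih =>
    obtain ⟨h1, h2, h3, h4⟩ := ih
    rw [List.foldr_cons]
    rcases l with ⟨a | t, _ | _⟩ <;>
      simp_all [initLit, or_and_right, exists_or, or_assoc]

theorem foldr_checkLit (L : List ((A ⊕ T) × Bool)) (s : DerivState A T) :
    (L.foldr (fun l s => checkLit true l.2 l.1 s) s).derived = s.derived ∧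
    (L.foldr (fun l s => checkLit true l.2 l.1 s) s).queried = s.queried ∧
    ((L.foldr (fun l s => checkLit true l.2 l.1 s) s).reject = false ↔
      s.reject = false ∧ ∀ l ∈ L, l.2 = true ↔ some l.1 ∈ s.derived) := by
  induction L with
  | nil => simp
  | cons l L ih =>
    obtain ⟨h1, h2, h3⟩ := ih
    rw [List.foldr_cons]
    refine ⟨h1, h2, ?_⟩
    generalize L.foldr (fun l s => checkLit true l.2 l.1 s) s = s' at h1 h3 ⊢
    simp only [checkLit, Bool.or_eq_false_iff, h3, List.forall_mem_cons, and_assoc]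
    refine and_congr_right fun _ => ?_
    rw [and_comm]
    refine and_congr_left fun _ => ?_
    rcases l with ⟨a, _ | _⟩ <;> by_cases h : some a ∈ s.derived <;> simp [h1, h]

/-- The body of the rule is true if the positive literals belong to `D`, and the negative ones are
evaluated by their guessed truth values. -/
def GuessRule.Fires (D : Set (Option (A ⊕ T))) (r : GuessRule A T) : Prop :=
  (∀ l ∈ r.pos, some l.1 ∈ D) ∧ ∀ l ∈ r.neg, l.2 = false

theorem GuessRule.Fires.mono {D D' : Set (Option (A ⊕ T))} (h : D ⊆ D') {r : GuessRule A T}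
    (hr : r.Fires D) : r.Fires D' :=
  ⟨fun l hl => h (hr.1 l hl), hr.2⟩

/-- `D` contains the heads of all rules that fire. -/
def RuleClosed (P : List (GuessRule A T)) (D : Set (Option (A ⊕ T))) : Prop :=
  ∀ r ∈ P, r.Fires D → r.head ∈ D

open Classical in
theorem foldr_deriveLit (pos : Bool) (L : List ((A ⊕ T) × Bool)) (s : DerivState A T) :
    L.foldr (fun l s => deriveLit pos l.2 l.1 s) s =
      { s with
        applicable := s.applicable &&
          L.all (fun l => if pos then decide (some l.1 ∈ s.derived) else !l.2) } := by
  induction L with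
  | nil => simp
  | cons l L ih =>
    rw [List.foldr_cons, ih]
    simp [deriveLit, Bool.and_left_comm, Bool.and_comm]

-- The flag is true when a rule is entered and is reset at its head, so in between it records
-- whether the rule fires. Heads derived by `P` in the same round are already available.
open Classical in
theorem deriveRound_cons (r : GuessRule A T) (P : List (GuessRule A T)) (s : DerivState A T)
    (hs : (deriveRound P s).applicable = true) :
    deriveRound (r :: P) s = { deriveRound P s with
      derived := if r.Fires {x | x ∈ (deriveRound P s).derived}
        then r.head :: (deriveRound P s).derived else (deriveRound P s).derived
      applicable := true } := by
  change deriveRule r.head (r.pos.foldr (fun l s => deriveLit true l.2 l.1 s)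
    (r.neg.foldr (fun l s => deriveLit false l.2 l.1 s) (deriveRound P s))) = _
  rw [foldr_deriveLit, foldr_deriveLit, deriveRule]
  by_cases hF : r.Fires {x | x ∈ (deriveRound P s).derived}
  · rw [if_pos hF]
    have h2 := hF.2
    have h1 : ∀ l ∈ r.pos, some l.1 ∈ (deriveRound P s).derived := hF.1
    simp_all
  · rw [if_neg hF]
    have h1 : ¬ ((∀ l ∈ r.pos, some l.1 ∈ (deriveRound P s).derived) ∧
      ∀ l ∈ r.neg, l.2 = false) := hF
    simp only [hs]
    congr 1
    refine if_neg fun h => h1 ?_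
    simpa [and_comm] using h

theorem applicable_deriveRound (P : List (GuessRule A T)) {s : DerivState A T}
    (hs : s.applicable = true) : (deriveRound P s).applicable = true := by
  induction P with
  | nil => exact hs
  | cons r P ih => rw [deriveRound_cons r P s ih]

theorem deriveRound_subset {P : List (GuessRule A T)} {s : DerivState A T}
    (hs : s.applicable = true) {Z : Set (Option (A ⊕ T))} (hZ : RuleClosed P Z)
    (h : ∀ x ∈ s.derived, x ∈ Z) : ∀ x ∈ (deriveRound P s).derived, x ∈ Z := by
  induction P with
  | nil => exact h
  | cons r P ih =>
    have ih := ih fun r hr => hZ r (by simp [hr])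
    rw [deriveRound_cons r P s (applicable_deriveRound P hs)]
    intro x hx
    by_cases hr : r.Fires {x | x ∈ (deriveRound P s).derived}
    · simp only [hr, if_true, List.mem_cons] at hx
      rcases hx with rfl | hx
      · exact hZ r (by simp) (hr.mono ih)
      · exact ih x hx
    · simp only [hr, if_false] at hx
      exact ih x hx

theorem subset_deriveRound (P : List (GuessRule A T)) (s : DerivState A T) :
    ∀ x ∈ s.derived, x ∈ (deriveRound P s).derived := by
  intro x hx
  refine foldProgram_invariant (lit := deriveLit) (rule := deriveRule)
    (fun s : DerivState A T => x ∈ s.derived) (fun _ _ _ _ h => h) (fun h s hx => ?_) P hx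
  cases hs : s.applicable <;> simp [deriveRule, hs, hx]

theorem head_mem_deriveRound {P : List (GuessRule A T)} {s : DerivState A T}
    (hs : s.applicable = true) {r : GuessRule A T} (hr : r ∈ P)
    (hf : r.Fires {x | x ∈ s.derived}) : r.head ∈ (deriveRound P s).derived := by
  induction P with
  | nil => simp at hr
  | cons r' P ih =>
    rw [deriveRound_cons r' P s (applicable_deriveRound P hs)]
    rcases List.mem_cons.1 hr with rfl | hr
    · have : r.Fires {x | x ∈ (deriveRound P s).derived} := hf.mono (subset_deriveRound P s)
      simp [this]
    · by_cases h : r'.Fires {x | x ∈ (deriveRound P s).derived} <;> simp [h, ih hr]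

theorem iterate_deriveRound (P : List (GuessRule A T)) {s : DerivState A T}
    (hs : s.applicable = true) (k : ℕ) :
    ((deriveRound P)^[k] s).applicable = true ∧ ((deriveRound P)^[k] s).queried = s.queried ∧
      ((deriveRound P)^[k] s).reject = s.reject := by
  induction k with
  | zero => exact ⟨hs, rfl, rfl⟩
  | succ k ih =>
    rw [Function.iterate_succ_apply']
    refine ⟨applicable_deriveRound P ih.1, ?_⟩
    exact foldProgram_invariant (lit := deriveLit) (rule := deriveRule)
      (fun s' : DerivState A T => s'.queried = s.queried ∧ s'.reject = s.reject)
      (fun _ _ _ _ h => h) (fun _ _ h => h) P ih.2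

theorem iterate_deriveRound_mono (P : List (GuessRule A T)) (s : DerivState A T) {k m : ℕ}
    (h : k ≤ m) : ∀ x ∈ ((deriveRound P)^[k] s).derived, x ∈ ((deriveRound P)^[m] s).derived := by
  induction m, h using Nat.le_induction with
  | base => exact fun _ hx => hx
  | succ m _ ih =>
    rw [Function.iterate_succ_apply']
    exact fun x hx => subset_deriveRound _ _ x (ih x hx)

theorem iterate_deriveRound_subset {P : List (GuessRule A T)} {s : DerivState A T}
    (hs : s.applicable = true) {Z : Set (Option (A ⊕ T))} (hZ : RuleClosed P Z)
    (h : ∀ x ∈ s.derived, x ∈ Z) (k : ℕ) : ∀ x ∈ ((deriveRound P)^[k] s).derived, x ∈ Z := by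
  induction k with
  | zero => exact h
  | succ k ih =>
    rw [Function.iterate_succ_apply']
    exact deriveRound_subset (iterate_deriveRound P hs k).1 hZ ih

/-- A round that is not stable derives a new rule head, and there are at most `P.length` heads. -/
theorem exists_iterate_deriveRound_stable {P : List (GuessRule A T)} {s : DerivState A T}
    (hs : s.applicable = true) :
    ∃ k ≤ P.length, ∀ x ∈ ((deriveRound P)^[k + 1] s).derived,
      x ∈ ((deriveRound P)^[k] s).derived := by
  classical
  by_contra! hcon
  let F : ℕ → Finset (Option (A ⊕ T)) := fun k =>
    (P.map GuessRule.head).toFinset.filter fun x => x ∈ ((deriveRound P)^[k] s).derived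
  have hcard : ∀ k ≤ P.length + 1, k ≤ (F k).card := by
    intro k
    induction k with
    | zero => exact fun _ => Nat.zero_le _
    | succ k ih =>
      intro hk
      refine (ih (by omega)).trans_lt (Finset.card_lt_card ?_)
      obtain ⟨x, hx, hx'⟩ := hcon k (by omega)
      refine Finset.ssubset_iff_subset_ne.2 ⟨fun y hy => ?_, fun heq => ?_⟩
      · simp only [F, Finset.mem_filter] at hy ⊢
        exact ⟨hy.1, iterate_deriveRound_mono P s (Nat.le_succ k) y hy.2⟩
      · have hhead : x ∈ (P.map GuessRule.head).toFinset := by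
          rw [Function.iterate_succ_apply'] at hx
          -- A set containing all heads is trivially closed under the rules, so anything new must be
          -- a head.
          have := deriveRound_subset (Z := {y | y ∈ ((deriveRound P)^[k] s).derived ∨
            y ∈ P.map GuessRule.head}) (iterate_deriveRound P hs k).1
            (fun r hr _ => .inr (List.mem_map_of_mem hr)) (fun y hy => .inl hy) x hx
          simpa using this.resolve_left hx'
        have : x ∈ F (k + 1) := by simp only [F, Finset.mem_filter]; exact ⟨hhead, hx⟩
        rw [← heq] at this
        simp only [F, Finset.mem_filter] at this
        exact hx' this.2
  have h1 := hcard _ le_rfl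
  have h2 : (F (P.length + 1)).card ≤ P.length :=
    (Finset.card_filter_le _ _).trans ((List.toFinset_card_le _).trans (by simp))
  omega

/-- A round without new atoms witnesses closure; later rounds cannot leave a closed set, so they all
have the same elements. -/
theorem ruleClosed_iterate_deriveRound {P : List (GuessRule A T)} {s : DerivState A T}
    (hs : s.applicable = true) {m : ℕ} (hm : P.length ≤ m) :
    RuleClosed P {x | x ∈ ((deriveRound P)^[m] s).derived} := by
  obtain ⟨k, hk, hstable⟩ := exists_iterate_deriveRound_stable (P := P) hs
  have hclosed : RuleClosed P {x | x ∈ ((deriveRound P)^[k] s).derived} := by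
    intro r hr hf
    refine hstable _ ?_
    rw [Function.iterate_succ_apply']
    exact head_mem_deriveRound (iterate_deriveRound P hs k).1 hr hf
  have hle := iterate_deriveRound_mono P s (hk.trans hm)
  have hge := iterate_deriveRound_subset hs hclosed
    (fun x hx => iterate_deriveRound_mono P s (Nat.zero_le k) x hx) m
  intro r hr hf
  exact hle _ (hclosed r hr (hf.mono hge))

/-- `D` is the least set that contains the theory atoms that are guessed to be true and is closed
under the rules. -/
structure IsDerivedSet (P : List (GuessRule A T)) (D : Set (Option (A ⊕ T))) : Prop where
  guessed : ∀ t, (.inr t, true) ∈ bodyLits P → some (.inr t) ∈ D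
  closed : RuleClosed P D
  least : ∀ Z : Set (Option (A ⊕ T)), (∀ t, (.inr t, true) ∈ bodyLits P → some (.inr t) ∈ Z) →
    RuleClosed P Z → D ⊆ Z

variable (encA : Computability.Encoding A ΓA) (encT : Computability.Encoding T ΓT)

/-- The separator never occurs inside a name, so the list can be read back. This is needed because
the oracle language only provides some list with the given code. -/
theorem atomListCode_injective : Function.Injective (atomListCode encT) := by
  have hsplit : ∀ (x y : List ΓT) (l l' : List T),
      x.map some ++ atomListCode encT l = y.map some ++ atomListCode encT l' →
      x = y ∧ atomListCode encT l = atomListCode encT l' := by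
    intro x
    induction x with
    | nil =>
      intro y l l' h
      rcases y with _ | ⟨b, y⟩
      · exact ⟨rfl, by simpa using h⟩
      · rcases l with _ | ⟨s, l⟩ <;> simp [atomListCode] at h
    | cons a x ih =>
      intro y l l' h
      rcases y with _ | ⟨b, y⟩
      · rcases l' with _ | ⟨s, l'⟩ <;> simp [atomListCode] at h
      · simp only [List.map_cons, List.cons_append, List.cons.injEq, Option.some.injEq] at h
        obtain ⟨rfl, h⟩ := h
        exact (ih y l l' h).imp_left (congrArg _)
  intro l
  induction l with
  | nil =>
    intro l' h
    rcases l' with _ | ⟨s, l'⟩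
    · rfl
    · simp [atomListCode] at h
  | cons s l ih =>
    intro l' h
    rcases l' with _ | ⟨s', l'⟩
    · simp [atomListCode] at h
    · obtain ⟨h1, h2⟩ := hsplit (encT.encode s) (encT.encode s') l l'
        (by simpa [atomListCode] using h)
      rw [encT.encode_injective h1, ih h2]

theorem atomListCode_mem_theorySatLanguage {𝔗 : AbstractTheory T} {l : List T} :
    atomListCode encT l ∈ theorySatLanguage encT 𝔗 ↔ {s | s ∈ l} ∈ 𝔗.Sat := by
  constructor
  · rintro ⟨l', h, hl'⟩
    rwa [atomListCode_injective encT h]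
  · exact fun h => ⟨l, rfl, h⟩

/-- Every rule contributes at least its mark, so a copy of the program is a sufficient clock. -/
theorem length_le_length_guessWord (P : List (GuessRule A T)) :
    P.length ≤ (guessWord encA encT P).length := by
  induction P with
  | nil => exact Nat.zero_le _
  | cons r P ih =>
    simp only [guessWord, List.flatMap_cons, List.length_append, List.length_cons] at ih ⊢
    have : 1 ≤ (guessRuleWord encA encT r).length := by simp [guessRuleWord]
    omega

/-- This separates the machine from the semantics: `IsDerivedSet` determines `D`, and what follows
speaks only of sets of atoms. -/
theorem verifierAccepts_iff (𝔗 : AbstractTheory T) (P : List (GuessRule A T)) :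
    ∃ D, IsDerivedSet P D ∧
      (VerifierAccepts encA encT 𝔗.comp (theorySatLanguage encT 𝔗) P ↔
        (∀ l ∈ bodyLits P, l.2 = true ↔ some l.1 ∈ D) ∧ none ∉ D ∧
          {s | some (.inr s) ∈ D ∨ ∃ t, (.inr t, false) ∈ bodyLits P ∧ s = 𝔗.comp t} ∈ 𝔗.Sat) := by
  obtain ⟨hder, hq, happ, hrej⟩ := foldr_initLit 𝔗.comp (bodyLits P) (.init : DerivState A T)
  rw [← foldProgram_eq_foldr (initLit 𝔗.comp) rfl] at hder hq happ hrej
  change ∀ x, x ∈ (guessedState 𝔗.comp P).derived ↔ _ at hder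
  change ∀ x, x ∈ (guessedState 𝔗.comp P).queried ↔ _ at hq
  change (guessedState 𝔗.comp P).applicable = true at happ
  change (guessedState 𝔗.comp P).reject = false at hrej
  obtain ⟨-, hq', hrej'⟩ := iterate_deriveRound P happ (guessWord encA encT P).length
  change (derivedState encA encT 𝔗.comp P).queried = _ at hq'
  change (derivedState encA encT 𝔗.comp P).reject = _ at hrej'
  obtain ⟨hcd, hcq, hcr⟩ := foldr_checkLit (bodyLits P) (derivedState encA encT 𝔗.comp P)
  rw [← foldProgram_eq_foldr checkLit rfl] at hcd hcq hcr
  change (checkedState encA encT 𝔗.comp P).derived = _ at hcd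
  change (checkedState encA encT 𝔗.comp P).queried = _ at hcq
  change (checkedState encA encT 𝔗.comp P).reject = false ↔ _ at hcr
  refine ⟨{x | x ∈ (derivedState encA encT 𝔗.comp P).derived}, ⟨?_, ?_, ?_⟩, ?_⟩
  · intro t ht
    exact iterate_deriveRound_mono P _ (Nat.zero_le _) _ ((hder _).2 (.inl ⟨t, ht, rfl⟩))
  · exact ruleClosed_iterate_deriveRound happ (length_le_length_guessWord encA encT P)
  · intro Z hZ hZ'
    refine iterate_deriveRound_subset happ hZ' (fun x hx => ?_) _
    rcases (hder x).1 hx with ⟨t, ht, rfl⟩ | hx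
    · exact hZ t ht
    · simp [DerivState.init] at hx
  · unfold VerifierAccepts
    rw [hcr, hcd, hcq, hq', hrej', hrej, atomListCode_mem_theorySatLanguage]
    have hset : {s | s ∈ derivedTheoryAtoms (derivedState encA encT 𝔗.comp P).derived ++
        (guessedState 𝔗.comp P).queried} =
        {s | some (.inr s) ∈ {x | x ∈ (derivedState encA encT 𝔗.comp P).derived} ∨
          ∃ t, (.inr t, false) ∈ bodyLits P ∧ s = 𝔗.comp t} := by
      ext s
      simp only [Set.mem_ofPred_eq, List.mem_append, hq, DerivState.init, List.not_mem_nil,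
        or_false]
      refine or_congr_left ?_
      simp only [derivedTheoryAtoms, List.mem_filterMap, List.mem_reverse]
      constructor
      · rintro ⟨_ | a | t, hx, h⟩ <;> simp at h
        exact h ▸ hx
      · exact fun h => ⟨_, h, rfl⟩
    rw [hset]
    simp

end Derivation

/-! ## Stable models of programs -/

theorem mem_regularDen {C : Type*} {X : Set C} {a : C} :
    regularValuation X ∈ regularDen a ↔ a ∈ X := by
  simp [regularDen, regularValuation]

theorem exists_eq_regularValuation {C : Type*} (h : HTValuation C Unit) :
    ∃ H : Set C, h = regularValuation H := by
  refine ⟨{a | h a = some ()}, funext fun a => ?_⟩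
  rcases ha : h a with _ | ⟨⟩ <;> simp [regularValuation, ha]

theorem regularValuation_sub {C : Type*} {H X : Set C} :
    HTValuation.Sub (regularValuation H) (regularValuation X) ↔ H ⊆ X := by
  constructor
  · intro h a ha
    have := h a () (by simp [regularValuation, ha])
    exact mem_regularDen.1 this
  · intro h a d ha
    exact mem_regularDen.2 (h (mem_regularDen.1 ha))

theorem regularValuation_injective {C : Type*} :
    Function.Injective (regularValuation : Set C → HTValuation C Unit) := by
  intro H X h
  ext a
  rw [← mem_regularDen, h, mem_regularDen]

theorem htSat_conj {C X D : Type*} {den : C → Set (HTValuation X D)} {h t : HTValuation X D}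
    {l : List (HTFormula C)} : HTSat den h t (.conj l) ↔ ∀ φ ∈ l, HTSat den h t φ := by
  induction l with
  | nil => simp [HTFormula.conj, HTFormula.top, HTSat]
  | cons φ l ih => simp [HTFormula.conj, HTSat, ih]

section StableModels

variable {A T : Type*}

/-- The body of the rule is true in the interpretation `⟨H, X⟩`. -/
def TRule.Body (r : TRule A T) (H X : Set (A ⊕ T)) : Prop :=
  (∀ b ∈ r.pos, b ∈ H) ∧ ∀ b ∈ r.neg, b ∉ H ∧ b ∉ X

/-- The head of the rule belongs to `H`. -/
def TRule.HeadIn (r : TRule A T) (H : Set (A ⊕ T)) : Prop :=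
  ∃ a, r.head = some a ∧ a ∈ H

/-- Negation is an implication and is therefore evaluated in both worlds, which is why `Body`
excludes negated atoms from `H` and from `X`. -/
theorem htSat_toFormula {r : TRule A T} {H X : Set (A ⊕ T)} :
    HTSat regularDen (regularValuation H) (regularValuation X) r.toFormula ↔
      (r.Body H X → r.HeadIn H) ∧ (r.Body X X → r.HeadIn X) := by
  have hbody : ∀ H : Set (A ⊕ T), HTSat regularDen (regularValuation H) (regularValuation X)
      (.conj (r.pos.map .atom ++ r.neg.map fun b => .not (.atom b))) ↔ r.Body H X := by
    intro H
    rw [htSat_conj]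
    simp only [List.mem_append, List.mem_map, or_imp, forall_and, forall_exists_index, and_imp,
      forall_apply_eq_imp_iff₂, HTSat, HTFormula.not, mem_regularDen, or_false, TRule.Body]
  have hhead : ∀ H : Set (A ⊕ T), HTSat regularDen (regularValuation H) (regularValuation X)
      (match r.head with
        | none => .bot
        | some b => .atom b) ↔ r.HeadIn H := by
    intro H
    rcases r with ⟨_ | b, pos, neg⟩ <;> simp [TRule.HeadIn, HTSat, mem_regularDen]
  have himp : ∀ H : Set (A ⊕ T), _ ↔ (r.Body H X → r.HeadIn H) := fun H =>
    (or_congr (not_congr (hbody H)) (hhead H)).trans imp_iff_not_or.symm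
  exact and_congr (himp H) (himp X)

/-- The conditions on the upper world do not depend on `H` and already hold for `X`, so they drop
out of the minimality clause. -/
theorem isTheoryStableModel_iff {𝔗 : AbstractTheory T} {E : Set T} {P : Set (TRule A T)}
    {X : Set (A ⊕ T)} :
    IsTheoryStableModel 𝔗 E P X ↔ {s | Sum.inr s ∈ X} ∈ 𝔗.Sat ∧
      (∀ r ∈ P, r.Body X X → r.HeadIn X) ∧ (∀ s ∈ E, .inr s ∈ X ∨ .inr (𝔗.comp s) ∈ X) ∧
      ∀ H ⊆ X, (∀ r ∈ P, r.Body H X → r.HeadIn H) →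
        (∀ s ∈ E, .inr s ∈ H ∨ .inr (𝔗.comp s) ∈ H) → H = X := by
  have hsat : ∀ H : Set (A ⊕ T), (∀ φ ∈ TRule.toFormula '' P ∪
      (fun s => .or (.atom (Sum.inr s)) (.atom (Sum.inr (𝔗.comp s)))) '' E,
      HTSat regularDen (regularValuation H) (regularValuation X) φ) ↔
      (∀ r ∈ P, (r.Body H X → r.HeadIn H) ∧ (r.Body X X → r.HeadIn X)) ∧
        ∀ s ∈ E, .inr s ∈ H ∨ .inr (𝔗.comp s) ∈ H := by
    intro H
    simp only [Set.mem_union, or_imp, forall_and, Set.forall_mem_image, htSat_toFormula, HTSat,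
      mem_regularDen]
  rw [IsTheoryStableModel, IsRegularStableModel, IsStableModel, hsat]
  refine and_congr_right fun _ => ?_
  simp only [and_self, and_assoc]
  refine and_congr_right fun hP => and_congr_right fun hE => ?_
  constructor
  · intro h H hHX hHP hHE
    by_contra hne
    refine h ⟨regularValuation H, regularValuation_sub.2 hHX,
      fun heq => hne (regularValuation_injective heq), ?_⟩
    exact (hsat H).2 ⟨fun r hr => ⟨hHP r hr, hP r hr⟩, hHE⟩
  · rintro h ⟨h', hsub, hne, hh⟩
    obtain ⟨H, rfl⟩ := exists_eq_regularValuation h'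
    obtain ⟨h1, h2⟩ := (hsat H).1 hh
    exact hne (congrArg _ (h H (regularValuation_sub.1 hsub) (fun r hr => (h1 r hr).1) h2))

end StableModels

/-! ## Correctness of the guess -/

section Correctness

variable {A T ΓA ΓT : Type} {encA : Computability.Encoding A ΓA}
  {encT : Computability.Encoding T ΓT} {X D : Type*} {𝔗 : AbstractTheory T}

theorem TheoryStructure.Compositional.mem_sat_iff {𝔖 : TheoryStructure 𝔗 X D}
    (h : 𝔖.Compositional) {S : Set T} : S ∈ 𝔗.Sat ↔ ∃ v, ∀ s ∈ S, v ∈ 𝔖.den s := by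
  unfold TheoryStructure.Compositional at h
  rw [h]
  simp [TheoryStructure.denSet, Set.Nonempty]

theorem exists_rule_of_mem_bodyLits {P : List (GuessRule A T)} {l : (A ⊕ T) × Bool}
    (h : l ∈ bodyLits P) : ∃ r ∈ P.map GuessRule.erase, l.1 ∈ r.pos ∨ l.1 ∈ r.neg := by
  obtain ⟨r, hr, hl⟩ := List.mem_flatMap.1 h
  refine ⟨_, List.mem_map_of_mem hr, (List.mem_append.1 hl).imp ?_ ?_⟩ <;>
    exact fun h => List.mem_map_of_mem h

/-- If the guessed truth values are those of `Y` and `H ⊆ Y` contains the heads of the rules whose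
body is true, then `H` is closed under the rules. -/
theorem ruleClosed_image {P : List (GuessRule A T)} {H Y : Set (A ⊕ T)} (hHY : H ⊆ Y)
    (hbits : ∀ l ∈ bodyLits P, l.2 = true ↔ l.1 ∈ Y)
    (hH : ∀ r ∈ P.map GuessRule.erase, r.Body H Y → r.HeadIn H) : RuleClosed P (some '' H) := by
  rintro r hr ⟨hpos, hneg⟩
  suffices hbody : r.erase.Body H Y by
    obtain ⟨a, ha, haH⟩ := hH _ (List.mem_map_of_mem hr) hbody
    exact ⟨a, haH, ha.symm⟩
  refine ⟨?_, ?_⟩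
  · simp only [GuessRule.erase, List.mem_map, forall_exists_index, and_imp]
    rintro b l hl rfl
    simpa using hpos l hl
  · simp only [GuessRule.erase, List.mem_map, forall_exists_index, and_imp]
    rintro b l hl rfl
    have hY : l.1 ∉ Y := fun h => by
      have := (hbits l (List.mem_flatMap.2 ⟨r, hr, List.mem_append_right _ hl⟩)).2 h
      rw [hneg l hl] at this
      exact Bool.false_ne_true this
    exact ⟨fun h => hY (hHY h), hY⟩

/-- If the guessed truth values are those of `Y`, then a rule fires in a set that agrees with `H`
on the positive body atoms whenever its body is true in `⟨H, Y⟩`. -/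
theorem fires_of_body {P : List (GuessRule A T)} {H Y : Set (A ⊕ T)}
    {D : Set (Option (A ⊕ T))} (hbits : ∀ l ∈ bodyLits P, l.2 = true ↔ l.1 ∈ Y)
    (hD : ∀ l ∈ bodyLits P, l.1 ∈ H → some l.1 ∈ D) {r : GuessRule A T} (hr : r ∈ P)
    (h : r.erase.Body H Y) : r.Fires D := by
  refine ⟨fun l hl => ?_, fun l hl => ?_⟩
  · exact hD l (List.mem_flatMap.2 ⟨r, hr, List.mem_append_left _ hl⟩)
      (h.1 _ (List.mem_map_of_mem hl))
  · rw [← Bool.not_eq_true, hbits l (List.mem_flatMap.2 ⟨r, hr, List.mem_append_right _ hl⟩)]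
    exact (h.2 _ (List.mem_map_of_mem hl)).2

theorem TProgramInstance.mem_E_of_mem_bodyLits (i : TProgramInstance A 𝔗)
    {P : List (GuessRule A T)} (hP : P.map GuessRule.erase = i.rules) {t : T} {b : Bool}
    (h : (.inr t, b) ∈ bodyLits P) : t ∈ i.E := by
  obtain ⟨r, hr, hl⟩ := exists_rule_of_mem_bodyLits h
  exact i.body_external r (hP ▸ hr) t hl

theorem TProgramInstance.satisfiable_of_verifierAccepts {𝔖 : TheoryStructure 𝔗 X D}
    (h_compositional : 𝔖.Compositional) (h_absolute : 𝔖.AbsoluteComplement)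
    (i : TProgramInstance A 𝔗) {P : List (GuessRule A T)}
    (hP : P.map GuessRule.erase = i.rules)
    (h : VerifierAccepts encA encT 𝔗.comp (theorySatLanguage encT 𝔗) P) : i.Satisfiable := by
  obtain ⟨S, hS, hacc⟩ := verifierAccepts_iff encA encT 𝔗 P
  obtain ⟨hcheck, hbot, hsat⟩ := hacc.1 h
  obtain ⟨v, hv⟩ := h_compositional.mem_sat_iff.1 hsat
  have hcomp : ∀ s, v ∈ 𝔖.den (𝔗.comp s) ↔ v ∉ 𝔖.den s := fun s => by rw [h_absolute s]; rfl
  have hvS : ∀ s, some (.inr s) ∈ S → v ∈ 𝔖.den s := fun s hs => hv s (.inl hs)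
  -- The verifier does not evaluate external atoms outside the bodies; `v` decides them.
  let Y : Set (A ⊕ T) := {a | some a ∈ S ∨ ∃ s ∈ i.E, a = .inr s ∧ v ∈ 𝔖.den s}
  have hvY : ∀ s, .inr s ∈ Y → v ∈ 𝔖.den s := by
    rintro s (hs | ⟨s', -, hs, hv⟩)
    · exact hvS s hs
    · cases hs
      exact hv
  -- A body theory atom true under `v` cannot have been guessed false: its complement would have
  -- been in the query and true under `v` as well.
  have hbody : ∀ l ∈ bodyLits P, l.1 ∈ Y → some l.1 ∈ S := by
    rintro ⟨a, b⟩ hl (ha | ⟨s, -, rfl, hvs⟩)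
    · exact ha
    · refine (hcheck _ hl).1 ?_
      cases b with
      | true => rfl
      | false => exact absurd hvs ((hcomp s).1 (hv _ (.inr ⟨s, hl, rfl⟩)))
  have hbits : ∀ l ∈ bodyLits P, l.2 = true ↔ l.1 ∈ Y := fun l hl =>
    (hcheck l hl).trans ⟨.inl, hbody l hl⟩
  refine ⟨Y, isTheoryStableModel_iff.2
    ⟨h_compositional.mem_sat_iff.2 ⟨v, hvY⟩, ?_, ?_, ?_⟩⟩
  · intro r hr hrY
    rw [Set.mem_ofPred_eq, ← hP] at hr
    obtain ⟨r, hrP, rfl⟩ := List.mem_map.1 hr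
    have := hS.closed r hrP (fires_of_body hbits hbody hrP hrY)
    rcases ha : r.head with _ | a
    · exact absurd (ha ▸ this) hbot
    · exact ⟨a, ha, .inl (ha ▸ this)⟩
  · intro s hs
    by_cases hvs : v ∈ 𝔖.den s
    · exact .inl (.inr ⟨s, hs, rfl, hvs⟩)
    · exact .inr (.inr ⟨_, i.closed s hs, rfl, (hcomp s).2 hvs⟩)
  · intro H hHY hHr hHE
    -- The complement is false under `v`, hence not in `Y`, so the disjunction for `s` must be met
    -- by `s` itself.
    have hE : ∀ s ∈ i.E, v ∈ 𝔖.den s → .inr s ∈ H := fun s hs hvs =>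
      (hHE s hs).resolve_right fun h => (hcomp s).1 (hvY _ (hHY h)) hvs
    refine hHY.antisymm ?_
    have hle : S ⊆ some '' H := by
      refine hS.least _ (fun t ht => ⟨_, hE t (i.mem_E_of_mem_bodyLits hP ht) ?_, rfl⟩)
        (ruleClosed_image hHY hbits fun r hr => hHr r (hP ▸ hr))
      exact hvS t (hS.guessed t ht)
    rintro a (ha | ⟨s, hs, rfl, hvs⟩)
    · simpa using hle ha
    · exact hE s hs hvs

open Classical in
/-- The program in which the body literals are annotated by their truth values in `Y`. -/
noncomputable def guessOf (Y : Set (A ⊕ T)) (r : TRule A T) : GuessRule A T :=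
  ⟨r.head, r.pos.map fun b => (b, decide (b ∈ Y)), r.neg.map fun b => (b, decide (b ∈ Y))⟩

theorem erase_guessOf (Y : Set (A ⊕ T)) (r : TRule A T) : (guessOf Y r).erase = r := by
  simp [guessOf, GuessRule.erase, Function.comp_def]

theorem bodyLits_guessOf (Y : Set (A ⊕ T)) (P : List (TRule A T)) :
    ∀ l ∈ bodyLits (P.map (guessOf Y)), l.2 = true ↔ l.1 ∈ Y := by
  intro l hl
  obtain ⟨r', hr', hl⟩ := List.mem_flatMap.1 hl
  obtain ⟨r, -, rfl⟩ := List.mem_map.1 hr'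
  rcases List.mem_append.1 hl with hl | hl <;> obtain ⟨b, -, rfl⟩ := List.mem_map.1 hl <;> simp

theorem TProgramInstance.exists_verifierAccepts {𝔖 : TheoryStructure 𝔗 X D}
    (h_compositional : 𝔖.Compositional) (i : TProgramInstance A 𝔗) (h : i.Satisfiable) :
    ∃ P : List (GuessRule A T), P.map GuessRule.erase = i.rules ∧
      VerifierAccepts encA encT 𝔗.comp (theorySatLanguage encT 𝔗) P := by
  obtain ⟨Y, hY⟩ := h
  obtain ⟨hsat, hrules, hE, hmin⟩ := isTheoryStableModel_iff.1 hY
  obtain ⟨v, hv⟩ := h_compositional.mem_sat_iff.1 hsat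
  set P := i.rules.map (guessOf Y) with hPdef
  have hP : P.map GuessRule.erase = i.rules := by
    rw [hPdef, List.map_map]
    exact (List.map_congr_left fun r _ => erase_guessOf Y r).trans (List.map_id _)
  have hbits : ∀ l ∈ bodyLits P, l.2 = true ↔ l.1 ∈ Y := bodyLits_guessOf Y i.rules
  obtain ⟨S, hS, hacc⟩ := verifierAccepts_iff encA encT 𝔗 P
  have hSY : S ⊆ some '' Y :=
    hS.least _ (fun t ht => ⟨_, (hbits _ ht).1 rfl, rfl⟩)
      (ruleClosed_image subset_rfl hbits fun r hr => hrules r (hP ▸ hr))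
  -- The justified part of `Y`: atoms that are derived, or external and thus covered by a
  -- disjunction.
  let H : Set (A ⊕ T) := {a | a ∈ Y ∧ (some a ∈ S ∨ ∃ s ∈ i.E, a = .inr s)}
  have hbody : ∀ l ∈ bodyLits P, l.1 ∈ H → some l.1 ∈ S := by
    rintro ⟨a, b⟩ hl ⟨haY, ha | ⟨s, -, rfl⟩⟩
    · exact ha
    · have : b = true := (hbits _ hl).2 haY
      exact hS.guessed s (this ▸ hl)
  have hHY : H = Y := by
    refine hmin H (fun a ha => ha.1) (fun r hr hrH => ?_) fun s hs => ?_
    · rw [Set.mem_ofPred_eq, ← hP] at hr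
      obtain ⟨r, hrP, rfl⟩ := List.mem_map.1 hr
      have := hS.closed r hrP (fires_of_body hbits hbody hrP hrH)
      obtain ⟨a, haY, ha⟩ := hSY this
      exact ⟨a, ha.symm, haY, .inl (ha ▸ this)⟩
    · exact (hE s hs).imp (fun h => ⟨h, .inr ⟨s, hs, rfl⟩⟩)
        fun h => ⟨h, .inr ⟨_, i.closed s hs, rfl⟩⟩
  refine ⟨P, hP, hacc.2 ⟨fun l hl => (hbits l hl).trans ⟨fun h => ?_, fun h => ?_⟩, ?_, ?_⟩⟩
  · exact hbody l hl (hHY ▸ h)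
  · simpa using hSY h
  · intro h
    simpa using hSY h
  · refine h_compositional.mem_sat_iff.2 ⟨v, ?_⟩
    rintro s (hs | ⟨t, ht, rfl⟩)
    · exact hv s (by simpa using hSY hs)
    -- The atom `t` is external and guessed false, so `Y` contains its complement, which `v`
    -- therefore satisfies.
    · refine hv _ ((hE t (i.mem_E_of_mem_bodyLits hP ht)).resolve_left fun h => ?_)
      exact Bool.false_ne_true ((hbits _ ht).2 h)

end Correctness

/-! ### The polynomial time bound and the main theorem -/

open Polynomial in
/-- The running time of the verifier machine. -/
theorem exists_polynomial_eval_eq (time : ℕ[X]) (C : ℕ) :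
    ∃ p : ℕ[X], ∀ l, p.eval l = verifierBound time C l + 1 + (l + 1) := by
  refine ⟨X * (4 * ((X + 2) * X) + time.comp ((X + 2) * X) * ((2 * C + 1 : ℕ) : ℕ[X]) + 14) +
    (X + 1) * (X * (((X + 2) * X) * (2 * ((X + 2) * X) + 10) + 10) + 3) + (X + 2) * X + 10 + 1 +
    (X + 1), fun l => ?_⟩
  simp [Polynomial.eval_comp, verifierBound, derivedBound]

theorem mainTheorem9 {A T ΓA ΓT : Type} [Finite ΓA] [Finite ΓT]
    (encA : Computability.Encoding A ΓA) (encT : Computability.Encoding T ΓT)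
    {X D : Type*} (𝔗 : AbstractTheory T) (𝔖 : TheoryStructure 𝔗 X D)
    (h_consistent : 𝔗.Consistent) (h_compositional : 𝔖.Compositional)
    (h_absolute : 𝔖.AbsoluteComplement)
    (h_comp : Nonempty (Turing.TM2ComputableInPolyTime encT.encode encT.encode 𝔗.comp)) :
    InNPOracle (theorySatLanguage encT 𝔗)
      (fun i : TProgramInstance A 𝔗 => programCode encA encT i.rules)
      (fun i => i.Satisfiable) := by
  obtain ⟨hc⟩ := h_comp
  obtain ⟨p, hp⟩ := exists_polynomial_eval_eq hc.time hc.tm.pushBound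
  -- Machine and polynomial are fixed before the instance, so they cannot depend on `E`.
  refine ⟨verifierMachine (ΓA := ΓA) hc.toTM2ComputableAux, p, fun i => ?_⟩
  obtain ⟨h1, h2⟩ := (decides_verifierMachine encA encT (O := theorySatLanguage encT 𝔗)
    (fun t => ⟨hc.outputsFun t⟩) i.rules).haltsWithin_and_accepts_iff
  refine ⟨by simpa only [hp] using h1, h2.trans ⟨?_, ?_⟩⟩
  · rintro ⟨P, hP, hacc⟩
    exact i.satisfiable_of_verifierAccepts h_compositional h_absolute hP hacc
  · exact i.exists_verifierAccepts h_compositional
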